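/- Let $k,d\ge 0$ be integers, $n=k+d$, let $\Theta$ be a real antisymmetric $n\times n$ matrix and put $\sigma_\Theta(x,y)=e^{-\pi i\langle x,\Theta y\rangle}$ for $x,y\in\mathbb N^n$ (with $0\in\mathbb N$). Let $L_p$ ($p\in\mathbb N^n$) be the isometries on $\ell^2(\mathbb N^n)$ given on the canonical basis by $L_p\delta_q=\sigma_\Theta(p,q)\delta_{p+q}$, and let $\mathcal T=\mathcal T_r(\mathbb N^n,\sigma_\Theta)$ be the $\mathrm C^*$-algebra they generate. Let $r=(r_1,\dots,r_k,0,\dots,0)\in[0,\infty)^n$ with $r_1,\dots,r_k>0$, and let $\alpha$ be the one-parameter automorphism group of $\mathcal T$ given by $\alpha_t=\operatorname{Ad}u_t$, where $u_t\delta_q=e^{i\langle q,r\rangle t}\delta_q$; thus $\alpha_t(L_p)=e^{i\langle p,r\rangle t}L_p$. An element $A\in\mathcal T$ is called analytic if $t\mapsto\alpha_t(A)$ extends to an entire function $z\mapsto\alpha_z(A)\in\mathcal T$. A state $\varphi$ of $\mathcal T$ is a *$\mathrm{KMS}_\beta$ state* ($\beta\in\mathbb R$) if $\varphi(AB)=\varphi(B\alpha_{i\beta}(A))$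 for all analytic $A$ and all $B\in\mathcal T$; it is a *$\mathrm{KMS}_\infty$ state* if it is the weak* limit of a sequence of $\mathrm{KMS}_{\beta_j}$ states with $\beta_j\to\infty$; and it is a *ground state* if for all analytic $A,B\in\mathcal T$ the function $z\mapsto\varphi(A\alpha_z(B))$ is bounded on the upper half plane. Let $e_1,\dots,e_n$ be the standard generators of $\mathbb N^n$, and let $Q=\prod_{j=1}^k(1-L_{e_j}L_{e_j}^*)$, a projection in $\mathcal T$. For a state $\omega$ of the corner $Q\mathcal TQ$ (whose identity is $Q$) define $T_\infty(\omega)(X)=\omega(QXQ)$ for $X\in\mathcal T$. Then: 1. $T_\infty$ is an affine weak* homeomorphism of the state space of $Q\mathcal TQ$ onto the space of ground states of $(\mathcal T,\alpha)$; 2. $T_\infty$ restricts to an affine weak* homeomorphism of the space of tracial states of $Q\mathcal TQ$ onto the space of $\mathrm{KMS}_\infty$ states of $(\mathcal T,\alpha)$. -/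

import Mathlib

open scoped ComplexOrder Matrix

noncomputable section

/-! ### States, corners and equilibrium conditions -/

namespace OpAlg

/-- The state space of a (C*-)algebra `B` with identity element `u`: positive continuous functionals
taking the value `1` at `u`, with the topology inherited from the weak* topology. The identity is
an explicit argument so that corners `eAe`, with identity `e`, are covered too. -/
def stateSpace {B : Type*} [NonUnitalRing B] [StarRing B] [Module ℂ B] [TopologicalSpace B]
    (u : B) : Set (WeakDual ℂ B) :=
  {φ | (∀ b : B, 0 ≤ φ (star b * b)) ∧ φ u = 1}

def tracialStateSpace {B : Type*} [NonUnitalRing B] [StarRing B] [Module ℂ B] [TopologicalSpace B]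
    (u : B) : Set (WeakDual ℂ B) :=
  {φ | φ ∈ stateSpace u ∧ ∀ a b : B, φ (a * b) = φ (b * a)}

/-- The corner `eAe = {x | e x e = x}` determined by a projection `e`. -/
def corner {A : Type*} [Ring A] [StarRing A] [Algebra ℂ A] (e : A) (he : IsStarProjection e) :
    NonUnitalStarSubalgebra ℂ A where
  carrier := {x | e * x * e = x}
  add_mem' {x y} hx hy := by
    simp only [Set.mem_ofPred_eq] at *
    rw [mul_add, add_mul, hx, hy]
  zero_mem' := by simp
  mul_mem' {x y} hx hy := by
    simp only [Set.mem_ofPred_eq] at *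
    have h1 : e * x = x := by
      rw [← hx, ← mul_assoc, ← mul_assoc, he.isIdempotentElem.eq]
    have h2 : y * e = y := by
      rw [← hy, mul_assoc, he.isIdempotentElem.eq]
    rw [← mul_assoc, h1, mul_assoc, h2]
  smul_mem' c x hx := by
    simp only [Set.mem_ofPred_eq] at *
    rw [mul_smul_comm, smul_mul_assoc, hx]
  star_mem' {x} hx := by
    simp only [Set.mem_ofPred_eq] at *
    conv_rhs => rw [← hx]
    rw [star_mul, star_mul, he.isSelfAdjoint.star_eq, mul_assoc]

/-- The identity element `e` of the corner `eAe`. -/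
def cornerUnit {A : Type*} [Ring A] [StarRing A] [Algebra ℂ A] (e : A)
    (he : IsStarProjection e) : corner e he :=
  ⟨e, by
    change e * e * e = e
    rw [he.isIdempotentElem.eq, he.isIdempotentElem.eq]⟩

/-- The compression `x ↦ e x e` of `A` onto the corner `eAe`. -/
def compression {A : Type*} [Ring A] [StarRing A] [Algebra ℂ A] [TopologicalSpace A]
    [IsTopologicalRing A] (e : A) (he : IsStarProjection e) : A →L[ℂ] corner e he where
  toFun x := ⟨e * x * e, by
    change e * (e * x * e) * e = e * x * e
    rw [← mul_assoc, ← mul_assoc, he.isIdempotentElem.eq, mul_assoc, he.isIdempotentElem.eq]⟩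
  map_add' x y := Subtype.ext (by simp [mul_add, add_mul])
  map_smul' c x := Subtype.ext (by simp)
  cont := Continuous.subtype_mk (by fun_prop) _

/-- The map `ω ↦ (x ↦ ω (e x e))`. -/
def dilate {A : Type*} [Ring A] [StarRing A] [Algebra ℂ A] [TopologicalSpace A]
    [IsTopologicalRing A] (e : A) (he : IsStarProjection e)
    (ω : WeakDual ℂ (corner e he)) : WeakDual ℂ A :=
  StrongDual.toWeakDual ((WeakDual.toStrongDual ω).comp (compression e he))

/-- `f` is the entire extension `z ↦ α_z(a)` of `t ↦ α_t(a)`. The element `a` is analytic for `α`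
if such an `f` exists. -/
structure IsEntireOrbit {A : Type*} [NormedRing A] [StarRing A] [NormedAlgebra ℂ A]
    (α : ℝ → A →⋆ₐ[ℂ] A) (a : A) (f : ℂ → A) : Prop where
  differentiable : Differentiable ℂ f
  eq_real : ∀ t : ℝ, f (t : ℂ) = α t a

def groundStates {A : Type*} [NormedRing A] [StarRing A] [NormedAlgebra ℂ A]
    (α : ℝ → A →⋆ₐ[ℂ] A) : Set (WeakDual ℂ A) :=
  {φ | φ ∈ stateSpace (1 : A) ∧
    ∀ (a b : A) (g f : ℂ → A), IsEntireOrbit α a g → IsEntireOrbit α b f →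
      ∃ C : ℝ, ∀ z : ℂ, 0 < z.im → ‖φ (a * f z)‖ ≤ C}

/-- `KMS_β` states: `φ(ab) = φ(b α_{iβ}(a))` for analytic `a` and all `b`. -/
def kmsStates {A : Type*} [NormedRing A] [StarRing A] [NormedAlgebra ℂ A]
    (α : ℝ → A →⋆ₐ[ℂ] A) (β : ℝ) : Set (WeakDual ℂ A) :=
  {φ | φ ∈ stateSpace (1 : A) ∧
    ∀ (a : A) (f : ℂ → A), IsEntireOrbit α a f →
      ∀ b : A, φ (a * b) = φ (b * f (Complex.I * β))}

/-- `KMS_∞` states: weak* limits of `KMS_{β_j}` states along sequences `β_j → ∞`. -/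
def kmsInftyStates {A : Type*} [NormedRing A] [StarRing A] [NormedAlgebra ℂ A]
    (α : ℝ → A →⋆ₐ[ℂ] A) : Set (WeakDual ℂ A) :=
  {φ | ∃ (β : ℕ → ℝ) (ψ : ℕ → WeakDual ℂ A),
    Filter.Tendsto β Filter.atTop Filter.atTop ∧ (∀ j, ψ j ∈ kmsStates α (β j)) ∧
      Filter.Tendsto ψ Filter.atTop (nhds φ)}

/-- `T` restricts to an affine homeomorphism of the convex set `S` onto the convex set `S'`
(both with the subspace topology). -/
structure IsAffineHomeomorphOn {E F : Type*} [AddCommGroup E] [Module ℝ E] [TopologicalSpace E]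
    [AddCommGroup F] [Module ℝ F] [TopologicalSpace F] (T : E → F) (S : Set E) (S' : Set F) :
    Prop where
  convex_source : Convex ℝ S
  convex_target : Convex ℝ S'
  affine : ∀ x ∈ S, ∀ y ∈ S, ∀ a b : ℝ, 0 ≤ a → 0 ≤ b → a + b = 1 →
    T (a • x + b • y) = a • T x + b • T y
  homeomorph : ∃ h : S ≃ₜ S', ∀ x : S, (h x : F) = T x

end OpAlg

/-! ### Weighted shifts on `ℓ²` -/

namespace NCTorus

/-- The Hilbert space `ℓ²(ι)`. -/
abbrev Ell2 (ι : Type*) : Type _ := lp (fun _ : ι => ℂ) 2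

/-- The canonical basis vector `δ_i`. -/
def delta {ι : Type*} [DecidableEq ι] (i : ι) : Ell2 ι := lp.single 2 i (1 : ℂ)

theorem inner_delta {ι : Type*} [DecidableEq ι] (i : ι) (v : Ell2 ι) :
    inner ℂ (delta i) v = v i := by
  rw [delta, lp.inner_single_left]
  simp

theorem delta_apply {ι : Type*} [DecidableEq ι] (i j : ι) :
    (delta i : Ell2 ι) j = if j = i then 1 else 0 := by
  rw [delta, lp.single_apply, Pi.single_apply]

theorem orthonormal_weighted {ι : Type*} [DecidableEq ι] {g : ι → ι} (hg : Function.Injective g)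
    (w : ι → Circle) : Orthonormal ℂ (fun i => (w i : ℂ) • (delta (g i) : Ell2 ι)) := by
  rw [orthonormal_iff_ite]
  intro i j
  rw [inner_smul_left, inner_smul_right, inner_delta, delta_apply]
  by_cases h : i = j
  · subst h
    simp [← Circle.coe_inv_eq_conj]
  · simp [h, hg.ne h]

/-- The isometry of `ℓ²(ι)` with `δ_i ↦ w_i δ_{g i}`, where `g` is injective and the weights `w_i`
lie on the unit circle. -/
def shift {ι : Type*} [DecidableEq ι] (g : ι → ι) (hg : Function.Injective g) (w : ι → Circle) :
    Ell2 ι →L[ℂ] Ell2 ι :=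
  (orthonormal_weighted hg w).orthogonalFamily.linearIsometry.toContinuousLinearMap

theorem shift_delta {ι : Type*} [DecidableEq ι] (g : ι → ι) (hg : Function.Injective g)
    (w : ι → Circle) (i : ι) : shift g hg w (delta i) = (w i : ℂ) • delta (g i) := by
  change (orthonormal_weighted hg w).orthogonalFamily.linearIsometry (lp.single 2 i (1 : ℂ)) = _
  rw [OrthogonalFamily.linearIsometry_apply_single]
  simp

theorem clm_ext {ι : Type*} [DecidableEq ι] {S T : Ell2 ι →L[ℂ] Ell2 ι}
    (h : ∀ i, S (delta i) = T (delta i)) : S = T := by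
  ext1 v
  have hv := lp.hasSum_single (p := 2) (by norm_num) v
  have h1 := hv.mapL S
  have h2 := hv.mapL T
  have key : ∀ i, S (lp.single 2 i (v i)) = T (lp.single 2 i (v i)) := by
    intro i
    have : (lp.single 2 i (v i) : Ell2 ι) = v i • delta i := by
      rw [delta, ← lp.single_smul]; simp
    rw [this, map_smul, map_smul, h]
  simp only [key] at h1
  exact h1.unique h2

theorem star_shift_mul_shift {ι : Type*} [DecidableEq ι] (g : ι → ι) (hg : Function.Injective g)
    (w : ι → Circle) : star (shift g hg w) * shift g hg w = 1 := by
  rw [ContinuousLinearMap.star_eq_adjoint]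
  exact (ContinuousLinearMap.norm_map_iff_adjoint_comp_self _).1
    (fun v => (orthonormal_weighted hg w).orthogonalFamily.linearIsometry.norm_map v)

theorem star_shift_delta_of_notMem {ι : Type*} [DecidableEq ι] (g : ι → ι)
    (hg : Function.Injective g) (w : ι → Circle) {j : ι} (hj : ∀ i, g i ≠ j) :
    star (shift g hg w) (delta j) = 0 := by
  ext i
  rw [← inner_delta, ContinuousLinearMap.star_eq_adjoint, ContinuousLinearMap.adjoint_inner_right,
    shift_delta, inner_smul_left, inner_delta, delta_apply, if_neg (hj i)]
  simp

theorem star_shift_delta {ι : Type*} [DecidableEq ι] (g : ι → ι)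
    (hg : Function.Injective g) (w : ι → Circle) (i : ι) :
    star (shift g hg w) (delta (g i)) = (w i : ℂ)⁻¹ • delta i := by
  have h := congrArg (fun S => S (delta i)) (star_shift_mul_shift g hg w)
  simp only [mul_apply_eq_comp, shift_delta, map_smul,
    one_apply_eq_self] at h
  rw [← h, smul_smul, inv_mul_cancel₀ (Circle.coe_ne_zero _), one_smul]

/-- The diagonal unitary `δ_i ↦ w_i δ_i`. -/
def diagUnitary {ι : Type*} [DecidableEq ι] (w : ι → Circle) : unitary (Ell2 ι →L[ℂ] Ell2 ι) :=
  ⟨shift id Function.injective_id w, star_shift_mul_shift _ _ _, clm_ext fun i => by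
    have h := star_shift_delta id Function.injective_id w i
    rw [id] at h
    rw [mul_apply_eq_comp, h, map_smul, shift_delta, smul_smul,
      inv_mul_cancel₀ (Circle.coe_ne_zero _)]
    simp⟩

/-! ### The Toeplitz noncommutative torus -/

/-- The cocycle `σ_Θ(x, y) = exp(-π i ⟨x, Θ y⟩)` on `ℕⁿ`. -/
def cocycle {n : ℕ} (Θ : Matrix (Fin n) (Fin n) ℝ) (x y : Fin n → ℕ) : Circle :=
  Circle.exp (-Real.pi * ((fun i => (x i : ℝ)) ⬝ᵥ (Θ *ᵥ fun i => (y i : ℝ))))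

/-- The left regular `σ_Θ`-representation: `L_p δ_q = σ_Θ(p, q) δ_{p + q}` on `ℓ²(ℕⁿ)`. -/
def L {n : ℕ} (Θ : Matrix (Fin n) (Fin n) ℝ) (p : Fin n → ℕ) :
    Ell2 (Fin n → ℕ) →L[ℂ] Ell2 (Fin n → ℕ) :=
  shift (fun q => p + q) (add_right_injective p) (fun q => cocycle Θ p q)

/-- `𝒯_r(ℕⁿ, σ_Θ)`: the C*-subalgebra of the bounded operators on `ℓ²(ℕⁿ)` generated by the `L_p`. -/
def toeplitz {n : ℕ} (Θ : Matrix (Fin n) (Fin n) ℝ) :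
    StarSubalgebra ℂ (Ell2 (Fin n → ℕ) →L[ℂ] Ell2 (Fin n → ℕ)) :=
  (StarAlgebra.adjoin ℂ (Set.range (L Θ))).topologicalClosure

theorem L_mem {n : ℕ} (Θ : Matrix (Fin n) (Fin n) ℝ) (p : Fin n → ℕ) : L Θ p ∈ toeplitz Θ :=
  StarSubalgebra.le_topologicalClosure _ (StarAlgebra.subset_adjoin ℂ _ ⟨p, rfl⟩)

/-- The generator `L_p` as an element of `𝒯_r(ℕⁿ, σ_Θ)`. -/
def gen {n : ℕ} (Θ : Matrix (Fin n) (Fin n) ℝ) (p : Fin n → ℕ) : toeplitz Θ := ⟨L Θ p, L_mem Θ p⟩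

/-- The unitary `u_t^r δ_q = e^{i⟨q, r⟩t} δ_q`. -/
def timeUnitary {n : ℕ} (r : Fin n → ℝ) (t : ℝ) :
    unitary (Ell2 (Fin n → ℕ) →L[ℂ] Ell2 (Fin n → ℕ)) :=
  diagUnitary (fun q => Circle.exp (((fun i => (q i : ℝ)) ⬝ᵥ r) * t))

theorem conj_L {n : ℕ} (Θ : Matrix (Fin n) (Fin n) ℝ) (r : Fin n → ℝ) (t : ℝ) (p : Fin n → ℕ) :
    Unitary.conjStarAlgAut ℂ (Ell2 (Fin n → ℕ) →L[ℂ] Ell2 (Fin n → ℕ)) (timeUnitary r t) (L Θ p) =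
      (Circle.exp (((fun i => (p i : ℝ)) ⬝ᵥ r) * t) : ℂ) • L Θ p := by
  rw [Unitary.conjStarAlgAut_apply]
  have hu : (timeUnitary r t : Ell2 (Fin n → ℕ) →L[ℂ] Ell2 (Fin n → ℕ)) * L Θ p =
      ((Circle.exp (((fun i => (p i : ℝ)) ⬝ᵥ r) * t) : ℂ) • L Θ p) * timeUnitary r t := by
    refine clm_ext fun q => ?_
    simp only [mul_apply_eq_comp, timeUnitary, diagUnitary, L, shift_delta, map_smul,
      smul_apply, smul_smul, id]
    congr 1
    have : (fun i => (((p + q) i : ℕ) : ℝ)) = (fun i => (p i : ℝ)) + fun i => (q i : ℝ) := by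
      ext i; simp
    rw [this, add_dotProduct, add_mul, Circle.exp_add, Circle.coe_mul]
    ring
  rw [hu, mul_assoc]
  exact (congrArg _ (Unitary.coe_mul_star_self (timeUnitary (n := n) r t))).trans (mul_one _)

theorem conj_mem {n : ℕ} (Θ : Matrix (Fin n) (Fin n) ℝ) (r : Fin n → ℝ) (t : ℝ)
    (X : toeplitz Θ) :
    Unitary.conjStarAlgAut ℂ (Ell2 (Fin n → ℕ) →L[ℂ] Ell2 (Fin n → ℕ)) (timeUnitary r t) X ∈
      toeplitz Θ := by
  set f := Unitary.conjStarAlgAut ℂ (Ell2 (Fin n → ℕ) →L[ℂ] Ell2 (Fin n → ℕ)) (timeUnitary r t)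
    with hf
  have hcont : Continuous f := by
    have : (f : _ → _) = fun X => (timeUnitary r t : Ell2 (Fin n → ℕ) →L[ℂ] Ell2 (Fin n → ℕ)) * X *
        star (timeUnitary r t : Ell2 (Fin n → ℕ) →L[ℂ] Ell2 (Fin n → ℕ)) := by
      ext1 X; rw [hf, Unitary.conjStarAlgAut_apply]
    rw [this]
    fun_prop
  have hle : toeplitz Θ ≤ (toeplitz Θ).comap (f : _ →⋆ₐ[ℂ] _) := by
    refine StarSubalgebra.topologicalClosure_minimal ?_ ?_
    · refine StarAlgebra.adjoin_le ?_
      rintro _ ⟨p, rfl⟩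
      change f (L Θ p) ∈ toeplitz Θ
      rw [hf, conj_L]
      exact (toeplitz Θ).smul_mem (L_mem Θ p) _
    · exact (StarSubalgebra.isClosed_topologicalClosure _).preimage hcont
  exact hle X.2

/-- The dynamics `α_t^r` on `𝒯_r(ℕⁿ, σ_Θ)`: the restriction of conjugation by `u_t^r`. -/
def dynamics {n : ℕ} (Θ : Matrix (Fin n) (Fin n) ℝ) (r : Fin n → ℝ) (t : ℝ) :
    toeplitz Θ →⋆ₐ[ℂ] toeplitz Θ :=
  StarAlgHom.codRestrict
    (StarAlgHom.comp
      (StarAlgHomClass.toStarAlgHom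
        (Unitary.conjStarAlgAut ℂ (Ell2 (Fin n → ℕ) →L[ℂ] Ell2 (Fin n → ℕ)) (timeUnitary r t)))
      (toeplitz Θ).subtype) (toeplitz Θ) (conj_mem Θ r t)

theorem coe_dynamics {n : ℕ} (Θ : Matrix (Fin n) (Fin n) ℝ) (r : Fin n → ℝ) (t : ℝ)
    (X : toeplitz Θ) :
    (dynamics Θ r t X : Ell2 (Fin n → ℕ) →L[ℂ] Ell2 (Fin n → ℕ)) =
      (timeUnitary r t : Ell2 (Fin n → ℕ) →L[ℂ] Ell2 (Fin n → ℕ)) * X *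
        star (timeUnitary r t : Ell2 (Fin n → ℕ) →L[ℂ] Ell2 (Fin n → ℕ)) := rfl

theorem dynamics_gen {n : ℕ} (Θ : Matrix (Fin n) (Fin n) ℝ) (r : Fin n → ℝ) (t : ℝ)
    (p : Fin n → ℕ) :
    dynamics Θ r t (gen Θ p) =
      (Circle.exp (((fun i => (p i : ℝ)) ⬝ᵥ r) * t) : ℂ) • gen Θ p :=
  Subtype.ext (conj_L Θ r t p)

/-- The standard generator `e_j` of `ℕ^{k+d}`, for `j` among the first `k` coordinates. -/
def stdVec {k d : ℕ} (j : Fin k) : Fin (k + d) → ℕ := Pi.single (Fin.castAdd d j) 1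

/-- `Q = ∏_{j = 1}^{k} (1 - L_{e_j} L_{e_j}^*)`. -/
def projQ {k d : ℕ} (Θ : Matrix (Fin (k + d)) (Fin (k + d)) ℝ) : toeplitz Θ :=
  (List.ofFn fun j : Fin k => 1 - gen Θ (stdVec j) * star (gen Θ (stdVec j))).prod

/-- The vector `(r_1, …, r_k, 0, …, 0)`. -/
def extendZero {k d : ℕ} (r : Fin k → ℝ) : Fin (k + d) → ℝ := Fin.append r 0

/-- Operators on `ℓ²(ι)` that multiply each `δ_i` by `0` or `1` are projections. -/
theorem isStarProjection_of_diag {ι : Type*} [DecidableEq ι] {S : Ell2 ι →L[ℂ] Ell2 ι}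
    (h : ∀ i, S (delta i) = 0 ∨ S (delta i) = delta i) : IsStarProjection S := by
  refine ⟨clm_ext fun i => ?_, clm_ext fun i => ?_⟩
  · rw [mul_apply_eq_comp]
    rcases h i with h | h <;> simp [h]
  · ext j
    rw [← inner_delta, ← inner_delta, ContinuousLinearMap.star_eq_adjoint,
      ContinuousLinearMap.adjoint_inner_right]
    by_cases hij : i = j
    · subst hij
      rcases h i with h | h <;> simp [h]
    · have h0' : inner ℂ (delta j : Ell2 ι) (delta i) = 0 := by
        rw [inner_delta, delta_apply, if_neg (Ne.symm hij)]
      rcases h i with h1 | h1 <;> rcases h j with h2 | h2 <;> rw [h1, h2] <;>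
        simp only [inner_zero_left, inner_zero_right, h0']

theorem isStarProjection_projQ {k d : ℕ} (Θ : Matrix (Fin (k + d)) (Fin (k + d)) ℝ) :
    IsStarProjection (projQ Θ) := by
  have hfac : ∀ (p : Fin (k + d) → ℕ) (m : Fin (k + d) → ℕ),
      (1 - L Θ p * star (L Θ p)) (delta m) = 0 ∨
      (1 - L Θ p * star (L Θ p)) (delta m) = delta m := by
    intro p m
    by_cases hm : ∃ q, p + q = m
    · obtain ⟨q, rfl⟩ := hm
      left
      have h1 := star_shift_delta (fun q => p + q) (add_right_injective p)
        (fun q => cocycle Θ p q) q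
      rw [sub_apply, mul_apply_eq_comp, L]
      rw [h1, map_smul, shift_delta, smul_smul, inv_mul_cancel₀ (Circle.coe_ne_zero _)]
      simp
    · right
      push Not at hm
      rw [sub_apply, mul_apply_eq_comp, L,
        star_shift_delta_of_notMem _ _ _ hm]
      simp
  have hlist : ∀ l : List (Ell2 (Fin (k + d) → ℕ) →L[ℂ] Ell2 (Fin (k + d) → ℕ)),
      (∀ S ∈ l, ∀ m, S (delta m) = 0 ∨ S (delta m) = delta m) →
      ∀ m, l.prod (delta m) = 0 ∨ l.prod (delta m) = delta m := by
    intro l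
    induction l with
    | nil => intro _ m; right; simp
    | cons S l ih =>
      intro hl m
      rw [List.prod_cons, mul_apply_eq_comp]
      rcases ih (fun T hT => hl T (List.mem_cons_of_mem _ hT)) m with h | h
      · left; rw [h, map_zero]
      · rw [h]; exact hl S List.mem_cons_self m
  have hval : (projQ Θ : Ell2 (Fin (k + d) → ℕ) →L[ℂ] Ell2 (Fin (k + d) → ℕ)) =
      (List.ofFn fun j : Fin k => 1 - L Θ (stdVec j) * star (L Θ (stdVec j))).prod := by
    change (toeplitz Θ).subtype (projQ Θ) = _
    rw [projQ, map_list_prod, List.map_ofFn]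
    rfl
  have hQ : IsStarProjection
      (projQ Θ : Ell2 (Fin (k + d) → ℕ) →L[ℂ] Ell2 (Fin (k + d) → ℕ)) := by
    refine isStarProjection_of_diag fun m => ?_
    rw [hval]
    refine hlist _ (fun S hS => ?_) m
    rw [List.mem_ofFn] at hS
    obtain ⟨j, rfl⟩ := hS
    exact hfac _
  exact ⟨Subtype.ext hQ.isIdempotentElem, Subtype.ext hQ.isSelfAdjoint⟩

/-- The corner `Q 𝒯_r(ℕⁿ, σ_Θ) Q`. -/
abbrev cornerQ {k d : ℕ} (Θ : Matrix (Fin (k + d)) (Fin (k + d)) ℝ) :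
    NonUnitalStarSubalgebra ℂ (toeplitz Θ) :=
  OpAlg.corner (projQ Θ) (isStarProjection_projQ Θ)

/-- The identity element `Q` of the corner. -/
def unitQ {k d : ℕ} (Θ : Matrix (Fin (k + d)) (Fin (k + d)) ℝ) : cornerQ Θ :=
  OpAlg.cornerUnit (projQ Θ) (isStarProjection_projQ Θ)

/-- `T_∞(ω)(X) = ω(Q X Q)`. -/
def tInfty {k d : ℕ} (Θ : Matrix (Fin (k + d)) (Fin (k + d)) ℝ) (ω : WeakDual ℂ (cornerQ Θ)) :
    WeakDual ℂ (toeplitz Θ) :=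
  OpAlg.dilate (projQ Θ) (isStarProjection_projQ Θ) ω

end NCTorus

end

/-! Grade `ℓ²(ℕ^{k+d})` by the first `k` coordinates of the basis index, its level in `ℕ^k`. The
unitary `u_t` is the scalar `e^{i⟨q, r⟩t}` on level `q`, and `Q` is the projection onto level `0`.
As `r_1, …, r_k > 0`, level `0` is exactly the space of zero energy, and all other energies are
positive.

The map `T_∞` and the restriction of functionals to the corner are affine and weak* continuous, and
restriction undoes `T_∞`. They are mutually inverse on functionals with `φ(QxQ) = φ(x)`
(`isAffineHomeomorphOn_dilate`), so it remains to match the sets of states. By Cauchy-Schwarz, a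
state has this invariance once it vanishes on every `L_{e_j} L_{e_j}^*`, `j ≤ k`. For a ground state
it does, because `φ(L_{e_j} α_z(L_{e_j}^*))` otherwise grows like `e^{r_j Im z}`. A `KMS_β` state
takes the value `e^{-β r_j}` there, which tends to `0`.

Ground states: if `Im z > 0`, then `α_z` damps the level `q` component of `bQv` by `e^{-⟨q, r⟩ Im
z}`. Hence `‖α_z(b)Q‖ ≤ ‖bQ‖`, and every state of the corner dilates to a ground state.

`KMS_∞` states: corner elements are fixed by `α`, so a `KMS_β` state commutes with them, and so does
a limit of such states; its restriction is tracial. Conversely, let `φ` be the dilation of a tracial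
state. The Gibbs functional `Z⁻¹ ∑_p e^{-β⟨p, r⟩} φ(L_p^* x L_p)`, `p ∈ ℕ^k`, is a `KMS_β` state for
`β > 0`: the trace exchanges the two blocks of a product, and the weights absorb the resulting
energy difference. As `β → ∞` only `p = 0` survives, and the limit is `φ`. -/

noncomputable section

namespace OpAlg

/-! ### Functionals on an algebra and on a corner -/

section Corner

variable {A : Type*} [Ring A] [StarRing A] [Algebra ℂ A] {e : A} {he : IsStarProjection e}

variable [TopologicalSpace A]

/-- Restriction of functionals from `A` to the corner `eAe`. -/
def restrictCorner (e : A) (he : IsStarProjection e) (φ : WeakDual ℂ A) :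
    WeakDual ℂ (corner e he) :=
  StrongDual.toWeakDual ((WeakDual.toStrongDual φ).comp
    ({ toFun := fun x => (x : A)
       map_add' := fun _ _ => rfl
       map_smul' := fun _ _ => rfl
       cont := continuous_subtype_val } : corner e he →L[ℂ] A))

@[simp]
theorem restrictCorner_apply (φ : WeakDual ℂ A) (x : corner e he) :
    restrictCorner e he φ x = φ (x : A) := rfl

theorem continuous_restrictCorner : Continuous (restrictCorner e he) :=
  WeakDual.continuous_of_continuous_eval fun x => WeakDual.eval_continuous (x : A)

variable [IsTopologicalRing A]

theorem dilate_apply (ω : WeakDual ℂ (corner e he)) (x : A) :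
    dilate e he ω x = ω (compression e he x) := rfl

@[simp]
theorem coe_compression (x : A) : (compression e he x : A) = e * x * e := rfl

theorem compression_coe (x : corner e he) : compression e he (x : A) = x := Subtype.ext x.2

theorem compression_one : compression e he 1 = cornerUnit e he :=
  Subtype.ext (by rw [coe_compression, mul_one, he.isIdempotentElem.eq]; rfl)

theorem continuous_dilate : Continuous (dilate e he) :=
  WeakDual.continuous_of_continuous_eval fun x => WeakDual.eval_continuous (compression e he x)

theorem restrictCorner_dilate (ω : WeakDual ℂ (corner e he)) :
    restrictCorner e he (dilate e he ω) = ω := by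
  refine DFunLike.ext _ _ fun x => ?_
  rw [restrictCorner_apply, dilate_apply, compression_coe]

theorem dilate_restrictCorner {φ : WeakDual ℂ A} (h : ∀ x, φ (e * x * e) = φ x) :
    dilate e he (restrictCorner e he φ) = φ := by
  refine DFunLike.ext _ _ fun x => ?_
  rw [dilate_apply, restrictCorner_apply, coe_compression, h]

theorem dilate_eq_of_compression_eq (ω : WeakDual ℂ (corner e he)) {x y : A}
    (h : e * x * e = e * y * e) : dilate e he ω x = dilate e he ω y :=
  congrArg ω (Subtype.ext h)

theorem dilate_apply_compression (ω : WeakDual ℂ (corner e he)) (x : A) :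
    dilate e he ω (e * x * e) = dilate e he ω x :=
  congrArg ω (compression_coe (compression e he x))

/-- Expresses the trace property of `ω` inside `A`, the form in which the Gibbs computation uses it.
-/
theorem dilate_mul_comm {ω : WeakDual ℂ (corner e he)} (hω : ∀ x y, ω (x * y) = ω (y * x))
    (x y : A) :
    dilate e he ω (e * x * e * (e * y * e)) = dilate e he ω (e * y * e * (e * x * e)) := by
  have h : ∀ x y : A, dilate e he ω (e * x * e * (e * y * e)) =
      ω (compression e he x * compression e he y) := fun x y =>
    congrArg ω (compression_coe (compression e he x * compression e he y))
  rw [h, h, hω]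

/-- Restriction to the corner is the continuous inverse. Convexity of `S'` is inherited from `S`: a
convex combination in `S'` is the dilation of the combination of the restrictions. -/
theorem isAffineHomeomorphOn_dilate {S : Set (WeakDual ℂ (corner e he))} {S' : Set (WeakDual ℂ A)}
    (hS : Convex ℝ S) (hmaps : ∀ ω ∈ S, dilate e he ω ∈ S')
    (hcomp : ∀ φ ∈ S', ∀ x, φ (e * x * e) = φ x)
    (hrestr : ∀ φ ∈ S', restrictCorner e he φ ∈ S) :
    IsAffineHomeomorphOn (dilate e he) S S' := by
  have haff : ∀ x y : WeakDual ℂ (corner e he), ∀ a b : ℝ,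
      dilate e he (a • x + b • y) = a • dilate e he x + b • dilate e he y := fun _ _ _ _ => rfl
  refine ⟨hS, ?_, fun x _ y _ a b _ _ _ => haff x y a b, ?_⟩
  · intro x hx y hy a b ha hb hab
    have := hmaps _ (hS (hrestr x hx) (hrestr y hy) ha hb hab)
    rwa [haff, dilate_restrictCorner (hcomp x hx), dilate_restrictCorner (hcomp y hy)] at this
  · exact ⟨{ toFun := fun x => ⟨dilate e he x, hmaps x x.2⟩
             invFun := fun y => ⟨restrictCorner e he y, hrestr y y.2⟩
             left_inv := fun x => Subtype.ext (restrictCorner_dilate _)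
             right_inv := fun y => Subtype.ext (dilate_restrictCorner (hcomp y y.2))
             continuous_toFun := (continuous_dilate.comp continuous_subtype_val).subtype_mk _
             continuous_invFun := (continuous_restrictCorner.comp continuous_subtype_val).subtype_mk
              _ }, fun _ => rfl⟩

theorem restrictCorner_mem_stateSpace {φ : WeakDual ℂ A} (hφ : φ ∈ stateSpace (1 : A))
    (h : ∀ x, φ (e * x * e) = φ x) : restrictCorner e he φ ∈ stateSpace (cornerUnit e he) := by
  refine ⟨fun b => hφ.1 b, ?_⟩
  rw [← compression_one, restrictCorner_apply, coe_compression, h]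
  exact hφ.2

end Corner

/-! ### Density and convexity for functionals -/

theorem weakDual_apply_smul {A : Type*} [AddCommMonoid A] [Module ℂ A] [TopologicalSpace A]
    (φ : WeakDual ℂ A) (c : ℂ) (x : A) : φ (c • x) = c * φ x := map_smul φ c x

/-- Both sides are linear and continuous in `b`. This reduces the KMS condition to homogeneous `b`,
with `a` an arbitrary analytic element. -/
theorem weakDual_eq_of_dense_span {A : Type*} [NormedRing A] [NormedAlgebra ℂ A]
    {ψ : WeakDual ℂ A} {s : Set A} (hs : Dense (Submodule.span ℂ s : Set A)) {a c : A}
    (h : ∀ b ∈ s, ψ (a * b) = ψ (b * c)) (b : A) : ψ (a * b) = ψ (b * c) := by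
  have hc : IsClosed {b | ψ (a * b) = ψ (b * c)} :=
    isClosed_eq ((map_continuous ψ).comp (continuous_const_mul a))
      ((map_continuous ψ).comp (continuous_mul_const c))
  refine hc.closure_subset_iff.2 (fun b hb => ?_) (hs b)
  change ψ (a * b) = ψ (b * c)
  induction hb using Submodule.span_induction with
  | mem b hb => exact h b hb
  | zero => rw [mul_zero, zero_mul]
  | add x y _ _ hx hy => rw [mul_add, add_mul, map_add, map_add, hx, hy]
  | smul c x _ hx => rw [mul_smul_comm, smul_mul_assoc, map_smul, map_smul, hx]

section Convexity

variable {B : Type*} [NonUnitalRing B] [StarRing B] [Module ℂ B] [TopologicalSpace B]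

theorem convex_stateSpace (u : B) : Convex ℝ (stateSpace u) := by
  intro φ hφ ψ hψ a b ha hb hab
  refine ⟨fun x => ?_, ?_⟩
  · change 0 ≤ a • φ (star x * x) + b • ψ (star x * x)
    exact add_nonneg (smul_nonneg ha (hφ.1 x)) (smul_nonneg hb (hψ.1 x))
  · change a • φ u + b • ψ u = 1
    rw [hφ.2, hψ.2, ← add_smul, hab, one_smul]

theorem convex_tracialStateSpace (u : B) : Convex ℝ (tracialStateSpace u) := by
  intro φ hφ ψ hψ a b ha hb hab
  refine ⟨convex_stateSpace u hφ.1 hψ.1 ha hb hab, fun x y => ?_⟩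
  change a • φ (x * y) + b • ψ (x * y) = a • φ (y * x) + b • ψ (y * x)
  rw [hφ.2, hψ.2]

end Convexity

/-! ### States of a C*-algebra and projections -/

section CStar

variable {A : Type*} [CStarAlgebra A] {e : A} {he : IsStarProjection e}

/-- The compression of a positive element is positive in the corner. -/
theorem exists_star_mul_self_eq_compression (x : A) :
    ∃ y : corner e he, star y * y = compression e he (star x * x) := by
  let _ := CStarAlgebra.spectralOrder A
  have := CStarAlgebra.spectralOrderedRing A
  -- `x * e` need not lie in the corner, so it cannot serve as `y`; the positive square root of `e
  -- x* x e` does.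
  set a : A := star (x * e) * (x * e) with ha
  have ha0 : 0 ≤ a := star_mul_self_nonneg _
  have hae : e * (star x * x) * e = a := by
    rw [ha, star_mul, he.isSelfAdjoint.star_eq]; simp only [mul_assoc]
  have hss : CFC.sqrt a * CFC.sqrt a = a := CFC.sqrt_mul_sqrt_self a ha0
  have hsa : star (CFC.sqrt a) = CFC.sqrt a :=
    (IsSelfAdjoint.of_nonneg (CFC.sqrt_nonneg a)).star_eq
  have ha1 : a * (1 - e) = 0 := by
    rw [← hae, mul_sub, mul_one, mul_assoc _ e e, he.isIdempotentElem.eq, sub_self]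
  -- By the C*-identity, since `(1 - e) a (1 - e) = 0`.
  have h0 : CFC.sqrt a * (1 - e) = 0 := by
    rw [← CStarRing.star_mul_self_eq_zero_iff, star_mul, hsa, mul_assoc,
      ← mul_assoc (CFC.sqrt a), hss, ha1, mul_zero]
  have h1 : CFC.sqrt a * e = CFC.sqrt a := by
    rw [mul_sub, mul_one, sub_eq_zero] at h0; exact h0.symm
  have h2 : e * CFC.sqrt a = CFC.sqrt a := by
    have := congrArg star h1
    rwa [star_mul, hsa, he.isSelfAdjoint.star_eq] at this
  refine ⟨⟨CFC.sqrt a, ?_⟩, Subtype.ext ?_⟩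
  · change e * CFC.sqrt a * e = CFC.sqrt a
    rw [h2, h1]
  · change star (CFC.sqrt a) * CFC.sqrt a = e * (star x * x) * e
    rw [hsa, hss, hae]

theorem nonneg_apply_compression {ω : WeakDual ℂ (corner e he)}
    (hω : ω ∈ stateSpace (cornerUnit e he)) (x : A) :
    0 ≤ ω (compression e he (star x * x)) := by
  obtain ⟨y, hy⟩ := exists_star_mul_self_eq_compression (he := he) x
  rw [← hy]
  exact hω.1 y

theorem dilate_mem_stateSpace {ω : WeakDual ℂ (corner e he)}
    (hω : ω ∈ stateSpace (cornerUnit e he)) : dilate e he ω ∈ stateSpace (1 : A) :=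
  ⟨fun x => nonneg_apply_compression hω x, by
    rw [dilate_apply, compression_one]; exact hω.2⟩

theorem exists_positiveLinearMap {φ : WeakDual ℂ A} (hφ : φ ∈ stateSpace (1 : A))
    [PartialOrder A] [StarOrderedRing A] : ∃ f : A →ₚ[ℂ] ℂ, ∀ x, f x = φ x := by
  refine ⟨PositiveLinearMap.mk₀ (φ : A →ₗ[ℂ] ℂ) fun x hx => ?_, fun x => rfl⟩
  obtain ⟨b, rfl⟩ := CStarAlgebra.nonneg_iff_eq_star_mul_self.1 hx
  exact hφ.1 b

theorem apply_star_of_mem_stateSpace {φ : WeakDual ℂ A} (hφ : φ ∈ stateSpace (1 : A)) (x : A) :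
    φ (star x) = star (φ x) := by
  let _ := CStarAlgebra.spectralOrder A
  have := CStarAlgebra.spectralOrderedRing A
  obtain ⟨f, hf⟩ := exists_positiveLinearMap hφ
  rw [← hf, ← hf, map_star]

/-- By the Cauchy-Schwarz inequality, a projection on which a state vanishes lies in the
left kernel of the state. -/
theorem apply_mul_eq_zero {φ : WeakDual ℂ A} (hφ : φ ∈ stateSpace (1 : A)) {p : A}
    (hp : IsStarProjection p) (h0 : φ p = 0) (x : A) : φ (x * p) = 0 := by
  let _ := CStarAlgebra.spectralOrder A
  have := CStarAlgebra.spectralOrderedRing A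
  obtain ⟨f, hf⟩ := exists_positiveLinearMap hφ
  have h1 : ‖f.toPreGNS p‖ = 0 := by
    rw [f.preGNS_norm_def, f.ofPreGNS_toPreGNS, hf, hp.isSelfAdjoint.star_eq,
      hp.isIdempotentElem.eq, h0]
    simp
  have h2 := norm_inner_le_norm (𝕜 := ℂ) (f.toPreGNS (star x)) (f.toPreGNS p)
  rw [h1, mul_zero, f.preGNS_inner_def, f.ofPreGNS_toPreGNS, f.ofPreGNS_toPreGNS, star_star,
    hf] at h2
  exact norm_le_zero_iff.1 h2

/-- Since `φ(x(1 - q)) = 0`, the factors `q` can be stripped from the right one at a time. The left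
factor `e` goes the same way after taking adjoints, as `φ` is hermitian. -/
theorem apply_compression_of_apply_prod {φ : WeakDual ℂ A} (hφ : φ ∈ stateSpace (1 : A))
    (he : IsStarProjection e) {l : List A} (hl : l.prod = e)
    (h : ∀ q ∈ l, IsStarProjection (1 - q) ∧ φ (1 - q) = 0) (x : A) :
    φ (e * x * e) = φ x := by
  have key : ∀ l : List A, (∀ q ∈ l, IsStarProjection (1 - q) ∧ φ (1 - q) = 0) →
      ∀ x, φ (x * l.prod) = φ x := by
    intro l
    induction l with
    | nil => intro _ x; simp
    | cons q l ih =>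
      intro h x
      have hq := h q List.mem_cons_self
      rw [List.prod_cons, ← mul_assoc, ih (fun p hp => h p (List.mem_cons_of_mem _ hp))]
      have := apply_mul_eq_zero hφ hq.1 hq.2 x
      rw [mul_sub, mul_one, map_sub, sub_eq_zero] at this
      exact this.symm
  have hr : ∀ x, φ (x * e) = φ x := fun x => hl ▸ key l h x
  rw [hr, ← star_star (e * x), apply_star_of_mem_stateSpace hφ, star_mul,
    he.isSelfAdjoint.star_eq, hr, ← apply_star_of_mem_stateSpace hφ, star_star]

end CStar

/-! ### Entire extensions of orbits -/

open Filter Topology in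
/-- Continuous linear maps that intertwine `α` with a character of `ℝ` do so for the entire
extension of orbits as well. -/
theorem IsEntireOrbit.map_eq_exp_smul {A F : Type*} [NormedRing A] [StarRing A] [NormedAlgebra ℂ A]
    [NormedAddCommGroup F] [NormedSpace ℂ F] [CompleteSpace F] {α : ℝ → A →⋆ₐ[ℂ] A} {a : A}
    {f : ℂ → A} (hf : IsEntireOrbit α a f) (ℓ : A →L[ℂ] F) (c : ℝ)
    (h : ∀ t : ℝ, ℓ (α t a) = Complex.exp (c * t * Complex.I) • ℓ a) (z : ℂ) :
    ℓ (f z) = Complex.exp (c * z * Complex.I) • ℓ a := by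
  have h1 : AnalyticOnNhd ℂ (fun z => ℓ (f z)) Set.univ :=
    (Differentiable.differentiableOn (by
      exact ℓ.differentiable.comp hf.differentiable)).analyticOnNhd isOpen_univ
  have h2 : AnalyticOnNhd ℂ (fun z => Complex.exp (c * z * Complex.I) • ℓ a) Set.univ :=
    (Differentiable.differentiableOn (by fun_prop)).analyticOnNhd isOpen_univ
  -- Both sides are entire and agree on the real line; the points `1/(n+1)`, accumulating at `0`,
  -- suffice for the identity theorem.
  have hlim : Tendsto (fun n : ℕ => (((1 / ((n : ℝ) + 1) : ℝ)) : ℂ)) atTop (𝓝[≠] 0) := by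
    refine tendsto_nhdsWithin_iff.2 ⟨?_, Eventually.of_forall fun n => ?_⟩
    · have := (Complex.continuous_ofReal.tendsto 0).comp
        (tendsto_one_div_add_atTop_nhds_zero_nat (𝕜 := ℝ))
      simpa [Function.comp_def] using this
    · exact Complex.ofReal_ne_zero.2 (by positivity)
  have h3 := h1.eq_of_frequently_eq h2 (z₀ := 0) (hlim.frequently
    (Frequently.of_forall fun n => by rw [hf.eq_real, h]))
  exact congrFun h3 z

end OpAlg

namespace NCTorus

open OpAlg

/-! ### Matrix coefficients of operators on `ℓ²` -/

section Ell2

variable {ι : Type*}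

theorem norm_le_of_coord_le {u v : Ell2 ι} (h : ∀ i, ‖u i‖ ≤ ‖v i‖) : ‖u‖ ≤ ‖v‖ := by
  have h2 : (0 : ℝ) < (2 : ENNReal).toReal := by norm_num
  rw [lp.norm_eq_tsum_rpow h2, lp.norm_eq_tsum_rpow h2]
  refine Real.rpow_le_rpow (tsum_nonneg fun i => by positivity) ?_ (by positivity)
  exact Summable.tsum_le_tsum (fun i => Real.rpow_le_rpow (norm_nonneg _) (h i) h2.le)
    ((lp.memℓp u).summable h2) ((lp.memℓp v).summable h2)

variable [DecidableEq ι]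

theorem coe_delta_eq_inner (S : Ell2 ι →L[ℂ] Ell2 ι) (v : Ell2 ι) (i : ι) :
    S v i = inner ℂ (star S (delta i)) v := by
  rw [ContinuousLinearMap.star_eq_adjoint, ContinuousLinearMap.adjoint_inner_left, inner_delta]

theorem star_apply_delta (S : Ell2 ι →L[ℂ] Ell2 ι) (i j : ι) :
    star S (delta i) j = star (S (delta j) i) := by
  rw [coe_delta_eq_inner, star_star, ← inner_delta, ← inner_conj_symm]
  rfl

/-- A diagonal operator acts coordinatewise. -/
theorem apply_of_diagonal {S : Ell2 ι →L[ℂ] Ell2 ι} {w : ι → ℂ}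
    (h : ∀ i, S (delta i) = w i • delta i) (v : Ell2 ι) (i : ι) : S v i = w i * v i := by
  have hs : star S (delta i) = star (w i) • delta i := by
    ext j
    rw [star_apply_delta, h]
    simp only [lp.coeFn_smul, Pi.smul_apply, delta_apply, smul_eq_mul]
    by_cases hij : i = j
    · subst hij; simp
    · simp [hij, Ne.symm hij]
  rw [coe_delta_eq_inner, hs, inner_smul_left, inner_delta]
  simp

/-- The coefficient of `S * T` is the sum over `l` of products of coefficients, so some term is
nonzero. -/
theorem exists_ne_zero_of_mul_apply_ne_zero {S T : Ell2 ι →L[ℂ] Ell2 ι} {i j : ι}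
    (h : (S * T) (delta j) i ≠ 0) : ∃ l, S (delta l) i ≠ 0 ∧ T (delta j) l ≠ 0 := by
  by_contra! hc
  refine h ?_
  rw [mul_apply_eq_comp, coe_delta_eq_inner, lp.inner_eq_tsum]
  refine (tsum_congr fun l => ?_).trans tsum_zero
  rw [star_apply_delta]
  by_cases hl : S (delta l) i = 0
  · rw [hl]; simp
  · rw [hc l hl]; simp

end Ell2

instance isClosed_toeplitz {n : ℕ} (Θ : Matrix (Fin n) (Fin n) ℝ) :
    IsClosed (toeplitz Θ : Set (Ell2 (Fin n → ℕ) →L[ℂ] Ell2 (Fin n → ℕ))) :=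
  StarSubalgebra.isClosed_topologicalClosure _

/-! ### Levels and the projections onto them -/

section Level

variable {k d : ℕ}

/-- The first `k` coordinates of a point of `ℕ^{k+d}`. -/
def level (x : Fin (k + d) → ℕ) : Fin k → ℕ := fun j => x (Fin.castAdd d j)

/-- The point of `ℕ^{k+d}` with first coordinates `q` and last coordinates `0`. -/
def ofLevel (d : ℕ) (q : Fin k → ℕ) : Fin (k + d) → ℕ := Fin.append q 0

@[simp]
theorem level_add (x y : Fin (k + d) → ℕ) : level (x + y) = level x + level y := rfl

@[simp]
theorem level_ofLevel (q : Fin k → ℕ) : level (ofLevel d q) = q := by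
  ext j; simp [level, ofLevel]

/-- The energy `⟨q, r⟩` of a point of `ℕ^k`. -/
def energy (r : Fin k → ℝ) (q : Fin k → ℕ) : ℝ := ∑ j, (q j : ℝ) * r j

theorem dotProduct_extendZero (r : Fin k → ℝ) (x : Fin (k + d) → ℕ) :
    (fun i => (x i : ℝ)) ⬝ᵥ extendZero (d := d) r = energy r (level x) := by
  simp [dotProduct, energy, extendZero, Fin.sum_univ_add, level]

theorem energy_zero (r : Fin k → ℝ) : energy r 0 = 0 := by simp [energy]

theorem energy_nonneg {r : Fin k → ℝ} (hr : ∀ j, 0 < r j) (q : Fin k → ℕ) : 0 ≤ energy r q :=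
  Finset.sum_nonneg fun j _ => mul_nonneg (Nat.cast_nonneg _) (hr j).le

theorem energy_pos {r : Fin k → ℝ} (hr : ∀ j, 0 < r j) {q : Fin k → ℕ} (hq : q ≠ 0) :
    0 < energy r q := by
  obtain ⟨j, hj⟩ := Function.ne_iff.1 hq
  refine Finset.sum_pos' (fun j _ => mul_nonneg (Nat.cast_nonneg _) (hr j).le)
    ⟨j, Finset.mem_univ _, mul_pos (Nat.cast_pos.2 (Nat.pos_of_ne_zero hj)) (hr j)⟩

variable (Θ : Matrix (Fin (k + d)) (Fin (k + d)) ℝ)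

theorem range_proj_delta_add {n : ℕ} (Θ : Matrix (Fin n) (Fin n) ℝ) (p q : Fin n → ℕ) :
    (L Θ p * star (L Θ p)) (delta (p + q)) = delta (p + q) := by
  have h1 := star_shift_delta (fun q => p + q) (add_right_injective p)
    (fun q => cocycle Θ p q) q
  rw [mul_apply_eq_comp, L]
  rw [h1, map_smul, shift_delta, smul_smul, inv_mul_cancel₀ (Circle.coe_ne_zero _), one_smul]

theorem star_L_delta_of_not_le {n : ℕ} (Θ : Matrix (Fin n) (Fin n) ℝ) {p x : Fin n → ℕ}
    (h : ¬ p ≤ x) : star (L Θ p) (delta x) = 0 := by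
  rw [L, star_shift_delta_of_notMem]
  rintro q rfl
  exact h le_self_add

theorem one_sub_range_proj_delta (j : Fin k) (x : Fin (k + d) → ℕ) :
    (1 - L Θ (stdVec j) * star (L Θ (stdVec j))) (delta x) =
      if level x j = 0 then delta x else 0 := by
  rw [sub_apply, one_apply_eq_self]
  by_cases hx : level x j = 0
  · rw [if_pos hx, mul_apply_eq_comp, star_L_delta_of_not_le, map_zero, sub_zero]
    intro h
    have := h (Fin.castAdd d j)
    rw [stdVec, Pi.single_eq_same, Nat.one_le_iff_ne_zero] at this
    exact this hx
  · have h : stdVec j ≤ x := by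
      intro i
      rw [stdVec, Pi.single_apply]
      split_ifs with hi
      · rw [hi]; exact Nat.one_le_iff_ne_zero.2 hx
      · exact Nat.zero_le _
    obtain ⟨q, rfl⟩ := exists_add_of_le h
    rw [if_neg hx, range_proj_delta_add, sub_self]

theorem ofFn_prod_delta {ι : Type*} [DecidableEq ι] {m : ℕ} (S : Fin m → Ell2 ι →L[ℂ] Ell2 ι)
    (x : ι) (P : Fin m → Prop) [DecidablePred P]
    (h : ∀ j, S j (delta x) = if P j then delta x else 0) :
    (List.ofFn S).prod (delta x) = if ∀ j, P j then delta x else 0 := by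
  induction m with
  | zero => simp
  | succ m ih =>
    rw [List.ofFn_succ, List.prod_cons, mul_apply_eq_comp, ih _ (fun j => P j.succ) fun j => h _]
    simp only [Fin.forall_fin_succ]
    by_cases h1 : ∀ j : Fin m, P j.succ
    · rw [if_pos h1, h]; simp [h1]
    · rw [if_neg h1, map_zero, if_neg (fun h => h1 h.2)]

theorem coe_projQ : (projQ Θ : Ell2 (Fin (k + d) → ℕ) →L[ℂ] Ell2 (Fin (k + d) → ℕ)) =
    (List.ofFn fun j : Fin k => 1 - L Θ (stdVec j) * star (L Θ (stdVec j))).prod := by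
  change (toeplitz Θ).subtype (projQ Θ) = _
  rw [projQ, map_list_prod, List.map_ofFn]
  rfl

theorem projQ_delta (x : Fin (k + d) → ℕ) :
    (projQ Θ : Ell2 (Fin (k + d) → ℕ) →L[ℂ] Ell2 (Fin (k + d) → ℕ)) (delta x) =
      if level x = 0 then delta x else 0 := by
  rw [coe_projQ, ofFn_prod_delta _ x (fun j => level x j = 0)
    fun j => one_sub_range_proj_delta Θ j x]
  simp only [funext_iff, Pi.zero_apply]

theorem projQ_apply (v : Ell2 (Fin (k + d) → ℕ)) (x : Fin (k + d) → ℕ) :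
    (projQ Θ : Ell2 (Fin (k + d) → ℕ) →L[ℂ] Ell2 (Fin (k + d) → ℕ)) v x =
      if level x = 0 then v x else 0 := by
  rw [apply_of_diagonal (w := fun x => if level x = 0 then 1 else 0)]
  · split_ifs <;> simp
  · intro x; rw [projQ_delta]; split_ifs <;> simp

/-- The isometry `L_q`, for `q` in the first factor of `ℕ^k × ℕ^d`. -/
def genLevel (q : Fin k → ℕ) : toeplitz Θ := gen Θ (ofLevel d q)

theorem star_gen_mul_gen {n : ℕ} (Θ : Matrix (Fin n) (Fin n) ℝ) (p : Fin n → ℕ) :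
    star (gen Θ p) * gen Θ p = 1 := Subtype.ext (star_shift_mul_shift _ (add_right_injective p) _)

theorem gen_zero {n : ℕ} (Θ : Matrix (Fin n) (Fin n) ℝ) : gen Θ 0 = 1 := by
  refine Subtype.ext (clm_ext fun x => ?_)
  change L Θ 0 (delta x) = delta x
  rw [L, shift_delta, zero_add, cocycle]
  simp [← Pi.zero_def]

theorem genLevel_zero : genLevel Θ 0 = 1 := by
  rw [genLevel, show ofLevel d (0 : Fin k → ℕ) = 0 from ?_, gen_zero]
  ext j
  refine Fin.addCases (fun i => ?_) (fun i => ?_) j <;> simp [ofLevel]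

/-- The projection `L_q Q L_q^*` onto the span of the basis vectors of level `q`. -/
def levelProj (q : Fin k → ℕ) : toeplitz Θ := genLevel Θ q * projQ Θ * star (genLevel Θ q)

/-- `L_q^*` kills `δ_x` unless `x ≥ (q, 0)`; otherwise it translates `x` back by `(q, 0)`, `Q` tests
whether level `0` is reached, and `L_q` restores `δ_x` with the phases cancelling. -/
theorem levelProj_apply (q : Fin k → ℕ) (v : Ell2 (Fin (k + d) → ℕ)) (x : Fin (k + d) → ℕ) :
    (levelProj Θ q : Ell2 (Fin (k + d) → ℕ) →L[ℂ] Ell2 (Fin (k + d) → ℕ)) v x =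
      if level x = q then v x else 0 := by
  rw [apply_of_diagonal (w := fun x => if level x = q then 1 else 0)]
  · split_ifs <;> simp
  intro x
  change L Θ (ofLevel d q) ((projQ Θ : Ell2 (Fin (k + d) → ℕ) →L[ℂ] Ell2 (Fin (k + d) → ℕ))
    (star (L Θ (ofLevel d q)) (delta x))) = _
  by_cases h : ofLevel d q ≤ x
  · obtain ⟨y, rfl⟩ := exists_add_of_le h
    have h1 := star_shift_delta (fun y => ofLevel d q + y) (add_right_injective (ofLevel d q))
      (fun y => cocycle Θ (ofLevel d q) y) y
    rw [L, h1, map_smul, projQ_delta, level_add, level_ofLevel]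
    by_cases hy : level y = 0
    · rw [if_pos hy, map_smul, shift_delta, smul_smul, inv_mul_cancel₀ (Circle.coe_ne_zero _),
        hy, add_zero, if_pos rfl]
    · rw [if_neg hy, if_neg (by simpa using hy), smul_zero, map_zero, zero_smul]
  · rw [star_L_delta_of_not_le Θ h, map_zero, map_zero, if_neg, zero_smul]
    rintro rfl
    refine h fun j => ?_
    refine Fin.addCases (fun i => ?_) (fun i => ?_) j <;> simp [ofLevel, level]

end Level

variable {k d : ℕ} (Θ : Matrix (Fin (k + d)) (Fin (k + d)) ℝ)

/-! ### Homogeneous elements for the `ℤ^k`-grading -/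

section Homogeneous

/-- An operator on `ℓ²(ℕ^{k+d})` that shifts the level by `m ∈ ℤ^k`. -/
def IsHomogeneous (m : Fin k → ℤ)
    (b : Ell2 (Fin (k + d) → ℕ) →L[ℂ] Ell2 (Fin (k + d) → ℕ)) : Prop :=
  ∀ x y, b (delta y) x ≠ 0 → ∀ j, (level x j : ℤ) = level y j + m j

variable {m m' : Fin k → ℤ} {b c : Ell2 (Fin (k + d) → ℕ) →L[ℂ] Ell2 (Fin (k + d) → ℕ)}

theorem IsHomogeneous.star (hb : IsHomogeneous m b) : IsHomogeneous (-m) (star b) := by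
  intro x y h j
  rw [star_apply_delta, star_ne_zero] at h
  have := hb y x h j
  simp only [Pi.neg_apply]
  omega

theorem IsHomogeneous.mul (hb : IsHomogeneous m b) (hc : IsHomogeneous m' c) :
    IsHomogeneous (m + m') (b * c) := by
  intro x y h j
  obtain ⟨l, h1, h2⟩ := exists_ne_zero_of_mul_apply_ne_zero h
  have := hb x l h1 j
  have := hc l y h2 j
  simp only [Pi.add_apply]
  omega

theorem isHomogeneous_one :
    IsHomogeneous (0 : Fin k → ℤ) (1 : Ell2 (Fin (k + d) → ℕ) →L[ℂ] Ell2 (Fin (k + d) → ℕ)) := by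
  intro x y h j
  rw [one_apply_eq_self, delta_apply] at h
  have : x = y := by by_contra hc; exact h (if_neg hc)
  simp [this]

theorem isHomogeneous_L (p : Fin (k + d) → ℕ) :
    IsHomogeneous (fun j => (level p j : ℤ)) (L Θ p) := by
  intro x y h j
  rw [L, shift_delta] at h
  have : x = p + y := by
    by_contra hc
    refine h ?_
    rw [lp.coeFn_smul, Pi.smul_apply, delta_apply, if_neg hc, smul_zero]
  rw [this, level_add, Pi.add_apply]
  push_cast
  ring

/-- The homogeneous elements of the Toeplitz algebra. -/
def homogeneousElements : Set (toeplitz Θ) := {b | ∃ m : Fin k → ℤ, IsHomogeneous m b.1}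

theorem star_mem_span_homogeneous {x : toeplitz Θ}
    (hx : x ∈ Submodule.span ℂ (homogeneousElements Θ)) :
    star x ∈ Submodule.span ℂ (homogeneousElements Θ) := by
  induction hx using Submodule.span_induction with
  | mem x hx =>
    obtain ⟨m, hm⟩ := hx
    exact Submodule.subset_span ⟨-m, hm.star⟩
  | zero => rw [star_zero]; exact Submodule.zero_mem _
  | add x y _ _ hx hy => rw [star_add]; exact Submodule.add_mem _ hx hy
  | smul a x _ hx => rw [star_smul]; exact Submodule.smul_mem _ _ hx

theorem mul_mem_span_homogeneous {x y : toeplitz Θ}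
    (hx : x ∈ Submodule.span ℂ (homogeneousElements Θ))
    (hy : y ∈ Submodule.span ℂ (homogeneousElements Θ)) :
    x * y ∈ Submodule.span ℂ (homogeneousElements Θ) := by
  have h := Submodule.mul_mem_mul hx hy
  rw [Submodule.span_mul_span] at h
  refine Submodule.span_mono ?_ h
  rintro _ ⟨x, ⟨m, hx⟩, y, ⟨m', hy⟩, rfl⟩
  exact ⟨m + m', hx.mul hy⟩

/-- The span is closed under products and adjoints and contains `1` and every `L_p`, hence the
*-algebra whose closure is the Toeplitz algebra. -/
theorem dense_span_homogeneous :
    Dense (Submodule.span ℂ (homogeneousElements Θ) : Set (toeplitz Θ)) := by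
  intro x
  rw [closure_subtype]
  have hx : (x : Ell2 (Fin (k + d) → ℕ) →L[ℂ] Ell2 (Fin (k + d) → ℕ)) ∈
      closure (StarAlgebra.adjoin ℂ (Set.range (L Θ)) : Set _) := x.2
  refine closure_mono (fun y hy => ?_) hx
  induction hy using StarAlgebra.adjoin_induction with
  | mem y hy =>
    obtain ⟨p, rfl⟩ := hy
    exact ⟨gen Θ p, Submodule.subset_span ⟨_, isHomogeneous_L Θ p⟩, rfl⟩
  | algebraMap a =>
    exact ⟨algebraMap ℂ _ a, by
      rw [Algebra.algebraMap_eq_smul_one]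
      exact Submodule.smul_mem _ _ (Submodule.subset_span ⟨0, isHomogeneous_one⟩), rfl⟩
  | add _ _ _ _ hx hy =>
    obtain ⟨x, hx, rfl⟩ := hx
    obtain ⟨y, hy, rfl⟩ := hy
    exact ⟨x + y, Submodule.add_mem _ hx hy, rfl⟩
  | mul _ _ _ _ hx hy =>
    obtain ⟨x, hx, rfl⟩ := hx
    obtain ⟨y, hy, rfl⟩ := hy
    exact ⟨x * y, mul_mem_span_homogeneous Θ hx hy, rfl⟩
  | star _ _ hx =>
    obtain ⟨x, hx, rfl⟩ := hx
    exact ⟨star x, star_mem_span_homogeneous Θ hx, rfl⟩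

/-- A homogeneous element of degree `m` maps level `p` to level `p + m`. -/
theorem level_of_mul_genLevel_mul_projQ {b : toeplitz Θ} (hb : IsHomogeneous m b.1)
    (p : Fin k → ℕ) {x y : Fin (k + d) → ℕ}
    (h : (b * genLevel Θ p * projQ Θ).1 (delta y) x ≠ 0) (j : Fin k) :
    (level x j : ℤ) = p j + m j := by
  obtain ⟨l, h1, h2⟩ := exists_ne_zero_of_mul_apply_ne_zero
    (S := (b * genLevel Θ p).1) (T := (projQ Θ).1) h
  rw [projQ_apply] at h2
  have hl : level l = 0 := by by_contra hc; exact h2 (if_neg hc)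
  have := hb.mul (isHomogeneous_L Θ (ofLevel d p)) x l h1 j
  rw [hl, level_ofLevel] at this
  simp only [Pi.add_apply, Pi.zero_apply, Nat.cast_zero] at this
  omega

/-- The range of `b L_p Q` lies in level `p + m = q`. This lets the single projection `L_q Q L_q^*`
be inserted in a product, splitting it into two corner elements. -/
theorem levelProj_mul_mul_genLevel_mul_projQ {b : toeplitz Θ} (hb : IsHomogeneous m b.1)
    {p q : Fin k → ℕ} (hpq : ∀ j, (q j : ℤ) = p j + m j) :
    levelProj Θ q * (b * genLevel Θ p * projQ Θ) = b * genLevel Θ p * projQ Θ := by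
  refine Subtype.ext (clm_ext fun y => ?_)
  ext x
  refine (levelProj_apply Θ q _ x).trans ?_
  split_ifs with h
  · rfl
  · by_contra hc
    refine h (funext fun j => ?_)
    have := level_of_mul_genLevel_mul_projQ Θ hb p (Ne.symm hc) j
    have := hpq j
    omega

/-- If `p + m` has a negative coordinate, there is no level for `b` to map into. -/
theorem mul_genLevel_mul_projQ_eq_zero {b : toeplitz Θ} (hb : IsHomogeneous m b.1)
    {p : Fin k → ℕ} (hp : ¬ ∃ q : Fin k → ℕ, ∀ j, (q j : ℤ) = p j + m j) :
    b * genLevel Θ p * projQ Θ = 0 := by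
  refine Subtype.ext (clm_ext fun y => ?_)
  ext x
  by_contra hc
  exact hp ⟨level x, level_of_mul_genLevel_mul_projQ Θ hb p hc⟩

theorem star_levelProj (q : Fin k → ℕ) : star (levelProj Θ q) = levelProj Θ q := by
  rw [levelProj, star_mul, star_mul, star_star, (isStarProjection_projQ Θ).isSelfAdjoint.star_eq,
    mul_assoc]

theorem projQ_mul_star_genLevel_mul {b : toeplitz Θ} (hb : IsHomogeneous m b.1)
    {p q : Fin k → ℕ} (hpq : ∀ j, (q j : ℤ) = p j + m j) :
    projQ Θ * star (genLevel Θ q) * b * levelProj Θ p = projQ Θ * star (genLevel Θ q) * b := by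
  have h := congrArg star (levelProj_mul_mul_genLevel_mul_projQ Θ (b := star b) hb.star
    (p := q) (q := p) fun j => by rw [hpq, Pi.neg_apply]; ring)
  simpa only [star_mul, star_star, (isStarProjection_projQ Θ).isSelfAdjoint.star_eq,
    star_levelProj, mul_assoc] using h

theorem projQ_mul_star_genLevel_mul_eq_zero {b : toeplitz Θ} (hb : IsHomogeneous m b.1)
    {q : Fin k → ℕ} (hq : ¬ ∃ p : Fin k → ℕ, ∀ j, (q j : ℤ) = p j + m j) :
    projQ Θ * star (genLevel Θ q) * b = 0 := by
  have h := congrArg star (mul_genLevel_mul_projQ_eq_zero Θ (b := star b) hb.star (p := q)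
    (by
      rintro ⟨p, hp⟩
      exact hq ⟨p, fun j => by rw [hp, Pi.neg_apply]; ring⟩))
  simpa only [star_mul, star_star, (isStarProjection_projQ Θ).isSelfAdjoint.star_eq,
    star_zero, mul_assoc] using h

end Homogeneous

/-! ### The dynamics relative to the levels -/

section Dynamics

variable (r : Fin k → ℝ)

theorem timeUnitary_apply {n : ℕ} (r : Fin n → ℝ) (t : ℝ) (v : Ell2 (Fin n → ℕ))
    (x : Fin n → ℕ) :
    (timeUnitary r t : Ell2 (Fin n → ℕ) →L[ℂ] Ell2 (Fin n → ℕ)) v x =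
      (Circle.exp (((fun i => (x i : ℝ)) ⬝ᵥ r) * t) : ℂ) * v x :=
  apply_of_diagonal (fun i => shift_delta id Function.injective_id _ i) v x

theorem timeUnitary_mul_projQ (t : ℝ) :
    (timeUnitary (extendZero (d := d) r) t).1 * (projQ Θ).1 = (projQ Θ).1 := by
  refine ContinuousLinearMap.ext fun v => ?_
  ext x
  rw [mul_apply_eq_comp, timeUnitary_apply, projQ_apply, dotProduct_extendZero]
  split_ifs with h
  · rw [h, energy_zero]; simp
  · rw [mul_zero]

theorem star_timeUnitary_mul_projQ (t : ℝ) :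
    star (timeUnitary (extendZero (d := d) r) t).1 * (projQ Θ).1 = (projQ Θ).1 := by
  conv_lhs => rw [← timeUnitary_mul_projQ Θ r t, ← mul_assoc]
  have := Unitary.coe_star_mul_self (timeUnitary (extendZero (d := d) r) t)
  exact (congrArg (· * _) this).trans (one_mul _)

/-- `u_t^*` is the identity on level `0`, so only the left factor of the conjugation remains, and it
acts on coordinates by phases. -/
theorem dynamics_mul_projQ (t : ℝ) (a : toeplitz Θ) :
    (dynamics Θ (extendZero r) t a * projQ Θ).1 =
      (timeUnitary (extendZero (d := d) r) t).1 * (a * projQ Θ).1 := by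
  change (dynamics Θ (extendZero r) t a).1 * (projQ Θ).1 = _ * (a.1 * (projQ Θ).1)
  rw [coe_dynamics, mul_assoc, star_timeUnitary_mul_projQ, mul_assoc]

theorem dynamics_corner (t : ℝ) (a : toeplitz Θ) :
    projQ Θ * dynamics Θ (extendZero r) t a * projQ Θ = projQ Θ * a * projQ Θ := by
  refine Subtype.ext ?_
  rw [mul_assoc, mul_assoc]
  change (projQ Θ).1 * (dynamics Θ (extendZero r) t a * projQ Θ).1 =
    (projQ Θ).1 * (a * projQ Θ).1
  rw [dynamics_mul_projQ, ← mul_assoc]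
  congr 1
  have h := congrArg star (star_timeUnitary_mul_projQ Θ r t)
  have hQ : star (projQ Θ).1 = (projQ Θ).1 :=
    congrArg Subtype.val (isStarProjection_projQ Θ).isSelfAdjoint.star_eq
  rwa [star_mul, star_star, hQ] at h

theorem dynamics_projQ (t : ℝ) : dynamics Θ (extendZero r) t (projQ Θ) = projQ Θ := by
  refine Subtype.ext ?_
  rw [coe_dynamics, timeUnitary_mul_projQ]
  have h := congrArg star (timeUnitary_mul_projQ Θ r t)
  have hQ : star (projQ Θ).1 = (projQ Θ).1 :=
    congrArg Subtype.val (isStarProjection_projQ Θ).isSelfAdjoint.star_eq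
  rwa [star_mul, hQ] at h

theorem dynamics_eq_self_of_corner (t : ℝ) {a : toeplitz Θ} (ha : projQ Θ * a * projQ Θ = a) :
    dynamics Θ (extendZero r) t a = a := by
  conv_lhs => rw [← ha]
  rw [map_mul, map_mul, dynamics_projQ, dynamics_corner, ha]

theorem dynamics_genLevel (t : ℝ) (p : Fin k → ℕ) :
    dynamics Θ (extendZero r) t (genLevel Θ p) =
      Complex.exp (energy r p * t * Complex.I) • genLevel Θ p := by
  rw [genLevel, dynamics_gen, dotProduct_extendZero, level_ofLevel, Circle.coe_exp]
  push_cast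
  rfl

theorem dynamics_star_genLevel (t : ℝ) (p : Fin k → ℕ) :
    dynamics Θ (extendZero r) t (star (genLevel Θ p)) =
      Complex.exp (-(energy r p * t * Complex.I)) • star (genLevel Θ p) := by
  have hs : star (Complex.exp (energy r p * t * Complex.I)) =
      Complex.exp (-(energy r p * t * Complex.I)) := by
    rw [RCLike.star_def, ← Complex.exp_conj]; simp
  rw [map_star, dynamics_genLevel, ← hs]
  exact star_smul _ _

variable {r} {a : toeplitz Θ} {f : ℂ → toeplitz Θ}

/-- For an entire orbit `f` of `a`, one has `‖f z v‖ ≤ ‖a v‖` on vectors `v` of level `0`, if `z`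
lies in the upper half plane. -/
theorem norm_entireOrbit_mul_projQ_le (hr : ∀ j, 0 < r j)
    (hf : IsEntireOrbit (dynamics Θ (extendZero r)) a f) {z : ℂ} (hz : 0 < z.im) :
    ‖f z * projQ Θ‖ ≤ ‖a * projQ Θ‖ := by
  refine ContinuousLinearMap.opNorm_le_bound _ (norm_nonneg _) fun v => ?_
  refine le_trans (norm_le_of_coord_le fun x => ?_) ((a * projQ Θ).1.le_opNorm v)
  -- `ℓ b` is the coordinate of `bQv` at `x`. Along the real orbit it acquires the phase of the
  -- energy of `x`, so at `z` its modulus is scaled by `e^{-energy · Im z} ≤ 1`.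
  let ℓ : toeplitz Θ →L[ℂ] ℂ :=
    (innerSL ℂ (delta x)).comp ((ContinuousLinearMap.apply ℂ _ ((projQ Θ).1 v)).comp
      (toeplitz Θ).toSubalgebra.toSubmodule.subtypeL)
  have hℓ : ∀ b : toeplitz Θ, ℓ b = (b * projQ Θ).1 v x := fun b => inner_delta _ _
  have h := hf.map_eq_exp_smul ℓ (energy r (level x)) (fun t => by
    rw [hℓ, dynamics_mul_projQ, mul_apply_eq_comp, timeUnitary_apply, ← hℓ, dotProduct_extendZero,
      Circle.coe_exp]
    push_cast
    rfl) z
  change ‖(f z * projQ Θ).1 v x‖ ≤ ‖(a * projQ Θ).1 v x‖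
  rw [← hℓ, ← hℓ, h, norm_smul, Complex.norm_exp]
  refine mul_le_of_le_one_left (norm_nonneg _) (Real.exp_le_one_iff.2 ?_)
  have := mul_nonneg (energy_nonneg hr (level x)) hz.le
  simpa using this

/-- The matrix coefficients of an entire orbit with respect to the levels. -/
theorem entireOrbit_coeff (hf : IsEntireOrbit (dynamics Θ (extendZero r)) a f)
    (p q : Fin k → ℕ) (z : ℂ) :
    projQ Θ * (star (genLevel Θ p) * f z * genLevel Θ q) * projQ Θ =
      Complex.exp (((energy r p - energy r q : ℝ) : ℂ) * z * Complex.I) •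
        (projQ Θ * (star (genLevel Θ p) * a * genLevel Θ q) * projQ Θ) := by
  let ℓ : toeplitz Θ →L[ℂ] toeplitz Θ :=
    (ContinuousLinearMap.mul ℂ _ (projQ Θ * star (genLevel Θ p))).comp
      ((ContinuousLinearMap.mul ℂ _).flip (genLevel Θ q * projQ Θ))
  have hℓ : ∀ b, ℓ b = projQ Θ * (star (genLevel Θ p) * b * genLevel Θ q) * projQ Θ := by
    intro b
    change projQ Θ * star (genLevel Θ p) * (b * (genLevel Θ q * projQ Θ)) = _
    simp only [mul_assoc]
  rw [← hℓ, ← hℓ]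
  refine hf.map_eq_exp_smul ℓ _ (fun t => ?_) z
  -- Compression by `Q` does not see `α_t`; expanding `α_t` on the product leaves the phases of
  -- `L_p^*` and `L_q`, which are then moved to the other side.
  have h := dynamics_corner Θ r t (star (genLevel Θ p) * a * genLevel Θ q)
  rw [map_mul, map_mul, dynamics_star_genLevel, dynamics_genLevel] at h
  simp only [smul_mul_assoc, mul_smul_comm, smul_smul] at h
  rw [hℓ, hℓ, ← h, smul_smul]
  have h0 : Complex.exp (((energy r p - energy r q : ℝ) : ℂ) * t * Complex.I) *
      (Complex.exp (energy r q * t * Complex.I) *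
        Complex.exp (-(energy r p * t * Complex.I))) = 1 := by
    rw [← Complex.exp_add, ← Complex.exp_add, ← Complex.exp_zero]
    congr 1
    push_cast
    ring
  exact ((congrArg (· • _) h0).trans (one_smul _ _)).symm

end Dynamics

end NCTorus

/-! ### Boltzmann weights and the partition function -/

/-- A series of uniformly bounded functionals with summable weights. -/
theorem OpAlg.exists_weakDual_eq_tsum {A P : Type*} [SeminormedAddCommGroup A] [NormedSpace ℂ A]
    {w : P → ℝ} (hw : Summable w) (hw0 : ∀ p, 0 ≤ w p) (c : ℝ) (ℓ : P → A →ₗ[ℂ] ℂ) {C : ℝ}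
    (hC : ∀ p x, ‖ℓ p x‖ ≤ C * ‖x‖) :
    ∃ ψ : WeakDual ℂ A, ∀ x, ψ x = c * ∑' p, (w p : ℂ) * ℓ p x := by
  have hb : ∀ x p, ‖(w p : ℂ) * ℓ p x‖ ≤ w p * (C * ‖x‖) := fun x p => by
    rw [norm_mul, Complex.norm_real, Real.norm_of_nonneg (hw0 p)]
    exact mul_le_mul_of_nonneg_left (hC p x) (hw0 p)
  have hs : ∀ x, Summable fun p => (w p : ℂ) * ℓ p x := fun x =>
    Summable.of_norm_bounded (hw.mul_right (C * ‖x‖)) (hb x)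
  let ψ : A →ₗ[ℂ] ℂ :=
    { toFun := fun x => c * ∑' p, (w p : ℂ) * ℓ p x
      map_add' := fun x y => by
        rw [← mul_add, ← (hs x).tsum_add (hs y)]
        simp only [mul_add, map_add]
      map_smul' := fun a x => by
        simp only [map_smul, smul_eq_mul, RingHom.id_apply, mul_left_comm _ a, tsum_mul_left] }
  refine ⟨StrongDual.toWeakDual (ψ.mkContinuous (‖(c : ℂ)‖ * ((∑' p, w p) * C)) fun x => ?_),
    fun x => rfl⟩
  rw [mul_assoc, mul_assoc]
  exact (norm_mul_le _ _).trans (mul_le_mul_of_nonneg_left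
    (tsum_of_norm_bounded (hw.hasSum.mul_right (C * ‖x‖)) (hb x)) (norm_nonneg _))

namespace NCTorus

open OpAlg Filter Topology

section Weight

variable {k : ℕ}

/-- The Boltzmann weight `e^{-β⟨p, r⟩}`. -/
def boltzmann (r : Fin k → ℝ) (β : ℝ) (p : Fin k → ℕ) : ℝ := Real.exp (-(β * energy r p))

variable {r : Fin k → ℝ} {β : ℝ}

theorem boltzmann_pos (p : Fin k → ℕ) : 0 < boltzmann r β p := Real.exp_pos _

theorem boltzmann_zero : boltzmann r β 0 = 1 := by simp [boltzmann, energy_zero]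

theorem boltzmann_eq_prod (p : Fin k → ℕ) :
    boltzmann r β p = ∏ j, Real.exp (-(β * r j)) ^ p j := by
  simp only [boltzmann, energy, ← Real.exp_nat_mul, ← Real.exp_sum]
  congr 1
  rw [Finset.mul_sum, ← Finset.sum_neg_distrib]
  exact Finset.sum_congr rfl fun j _ => by ring

/-- A finite set of indices lies in a box, over which the sum factors into partial sums of `k`
geometric series of ratio `e^{-β r_j} < 1`. -/
theorem summable_boltzmann (hr : ∀ j, 0 < r j) (hβ : 0 < β) : Summable (boltzmann r β) := by
  have hlt : ∀ j, Real.exp (-(β * r j)) < 1 := fun j =>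
    Real.exp_lt_one_iff.2 (neg_lt_zero.2 (mul_pos hβ (hr j)))
  refine summable_of_sum_le (c := ∏ j, (1 - Real.exp (-(β * r j)))⁻¹)
    (fun p => (boltzmann_pos p).le) fun u => ?_
  obtain ⟨N, hN⟩ : ∃ N : ℕ, ∀ p ∈ u, ∀ j, p j < N := by
    refine ⟨(u.sup fun p => ∑ j, p j) + 1, fun p hp j => Nat.lt_succ_of_le ?_⟩
    exact (Finset.single_le_sum (fun i _ => Nat.zero_le (p i)) (Finset.mem_univ j)).trans
      (Finset.le_sup (f := fun p : Fin k → ℕ => ∑ j, p j) hp)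
  calc ∑ p ∈ u, boltzmann r β p
      ≤ ∑ p ∈ Fintype.piFinset fun _ : Fin k => Finset.range N, boltzmann r β p :=
        Finset.sum_le_sum_of_subset_of_nonneg
          (fun p hp => Fintype.mem_piFinset.2 fun j => Finset.mem_range.2 (hN p hp j))
          fun p _ _ => (boltzmann_pos p).le
    _ = ∏ j, ∑ i ∈ Finset.range N, Real.exp (-(β * r j)) ^ i := by
        rw [Finset.prod_univ_sum]
        exact Finset.sum_congr rfl fun p _ => boltzmann_eq_prod p
    _ ≤ _ := Finset.prod_le_prod (fun j _ => Finset.sum_nonneg fun i _ => by positivity)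
        fun j _ => by
          rw [← tsum_geometric_of_lt_one (Real.exp_pos _).le (hlt j)]
          exact (summable_geometric_of_lt_one (Real.exp_pos _).le (hlt j)).sum_le_tsum _
            fun i _ => by positivity

/-- The partition function. -/
def partitionFn (r : Fin k → ℝ) (β : ℝ) : ℝ := ∑' p, boltzmann r β p

theorem partitionFn_pos (hr : ∀ j, 0 < r j) (hβ : 0 < β) : 0 < partitionFn r β :=
  (summable_boltzmann hr hβ).tsum_pos (fun p => (boltzmann_pos p).le) 0 (boltzmann_pos 0)

/-- As `β → ∞`, weighted sums concentrate at `0`. -/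
theorem tendsto_tsum_boltzmann_mul (hr : ∀ j, 0 < r j) {c : (Fin k → ℕ) → ℂ} {C : ℝ}
    (hc : ∀ p, ‖c p‖ ≤ C) :
    Tendsto (fun β => ∑' p, (boltzmann r β p : ℂ) * c p) atTop (𝓝 (c 0)) := by
  have h0 : ∑' p : Fin k → ℕ, (if p = 0 then c 0 else 0) = c 0 := tsum_ite_eq _ _
  rw [← h0]
  refine tendsto_tsum_of_dominated_convergence
    -- Energies are nonnegative, so the weights at `β = 1` dominate those for all `β ≥ 1`.
    (bound := fun p => boltzmann r 1 p * C)
    ((summable_boltzmann hr one_pos).mul_right C) (fun p => ?_) ?_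
  · split_ifs with hp
    · subst hp
      simp only [boltzmann_zero, Complex.ofReal_one, one_mul]
      exact tendsto_const_nhds
    · have h1 : Tendsto (fun β => boltzmann r β p) atTop (𝓝 0) :=
        Real.tendsto_exp_neg_atTop_nhds_zero.comp
          (tendsto_id.atTop_mul_const (energy_pos hr hp))
      have h2 := ((Complex.continuous_ofReal.tendsto 0).comp h1).mul_const (c p)
      simpa [Function.comp_def] using h2
  · filter_upwards [eventually_ge_atTop 1] with β hβ p
    rw [norm_mul, Complex.norm_real, Real.norm_of_nonneg (boltzmann_pos p).le]
    refine mul_le_mul ?_ (hc p) (norm_nonneg _) (boltzmann_pos p).le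
    exact Real.exp_le_exp.2 (neg_le_neg (mul_le_mul_of_nonneg_right hβ (energy_nonneg hr p)))

end Weight

/-! ### Gibbs functionals -/

section Gibbs

variable {k d : ℕ} {Θ : Matrix (Fin (k + d)) (Fin (k + d)) ℝ}

theorem norm_genLevel_le (p : Fin k → ℕ) : ‖genLevel Θ p‖ ≤ 1 := by
  have h1 : ‖(1 : toeplitz Θ)‖ ≤ 1 := ContinuousLinearMap.norm_id_le
  have h : ‖genLevel Θ p‖ * ‖genLevel Θ p‖ ≤ 1 := by
    rw [← CStarRing.norm_star_mul_self (x := genLevel Θ p), genLevel, star_gen_mul_gen]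
    exact h1
  nlinarith [norm_nonneg (genLevel Θ p)]

theorem norm_apply_conj_genLevel_le (φ : WeakDual ℂ (toeplitz Θ)) (p : Fin k → ℕ)
    (x : toeplitz Θ) :
    ‖φ (star (genLevel Θ p) * x * genLevel Θ p)‖ ≤ ‖WeakDual.toStrongDual φ‖ * ‖x‖ := by
  refine ((WeakDual.toStrongDual φ).le_opNorm _).trans ?_
  gcongr
  have h := norm_genLevel_le (Θ := Θ) p
  calc ‖star (genLevel Θ p) * x * genLevel Θ p‖
      ≤ ‖genLevel Θ p‖ * ‖x‖ * ‖genLevel Θ p‖ := by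
        refine (norm_mul_le _ _).trans ?_
        gcongr
        exact (norm_mul_le _ _).trans_eq (congrArg (· * _) (norm_star (genLevel Θ p)))
    _ ≤ 1 * ‖x‖ * 1 := by gcongr
    _ = ‖x‖ := by ring

variable {r : Fin k → ℝ} {β : ℝ}

theorem exists_gibbs (hr : ∀ j, 0 < r j) (hβ : 0 < β) (φ : WeakDual ℂ (toeplitz Θ)) :
    ∃ ψ : WeakDual ℂ (toeplitz Θ), ∀ x, ψ x = ((partitionFn r β)⁻¹ : ℝ) *
      ∑' p, (boltzmann r β p : ℂ) * φ (star (genLevel Θ p) * x * genLevel Θ p) :=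
  exists_weakDual_eq_tsum (summable_boltzmann hr hβ) (fun p => (boltzmann_pos p).le) _
    (fun p => φ.toLinearMap ∘ₗ LinearMap.mulLeftRight ℂ (star (genLevel Θ p), genLevel Θ p))
    (norm_apply_conj_genLevel_le φ)

/-- The functional `x ↦ Z⁻¹ ∑_p e^{-β⟨p, r⟩} φ(L_p^* x L_p)`, where `p` runs through `ℕ^k` and `Z`
is the partition function. -/
def gibbs (hr : ∀ j, 0 < r j) (hβ : 0 < β) (φ : WeakDual ℂ (toeplitz Θ)) :
    WeakDual ℂ (toeplitz Θ) := (exists_gibbs hr hβ φ).choose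

theorem gibbs_apply (hr : ∀ j, 0 < r j) (hβ : 0 < β) (φ : WeakDual ℂ (toeplitz Θ))
    (x : toeplitz Θ) :
    gibbs hr hβ φ x = ((partitionFn r β)⁻¹ : ℝ) *
      ∑' p, (boltzmann r β p : ℂ) * φ (star (genLevel Θ p) * x * genLevel Θ p) :=
  (exists_gibbs hr hβ φ).choose_spec x

theorem gibbs_mem_stateSpace (hr : ∀ j, 0 < r j) (hβ : 0 < β) {φ : WeakDual ℂ (toeplitz Θ)}
    (hφ : φ ∈ stateSpace (1 : toeplitz Θ)) : gibbs hr hβ φ ∈ stateSpace (1 : toeplitz Θ) := by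
  have hZ := partitionFn_pos hr hβ
  refine ⟨fun x => ?_, ?_⟩
  · rw [gibbs_apply]
    refine mul_nonneg ?_ (tsum_nonneg fun p => mul_nonneg ?_ ?_)
    · exact Complex.zero_le_real.2 (inv_pos.2 hZ).le
    · exact Complex.zero_le_real.2 (boltzmann_pos p).le
    · have h := hφ.1 (x * genLevel Θ p)
      rwa [star_mul, mul_assoc, ← mul_assoc (star x), ← mul_assoc] at h
  · rw [gibbs_apply]
    have h1 : ∀ p, (boltzmann r β p : ℂ) * φ (star (genLevel Θ p) * 1 * genLevel Θ p) =
        (boltzmann r β p : ℂ) := fun p => by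
      rw [mul_one, genLevel, star_gen_mul_gen, hφ.2, mul_one]
    rw [tsum_congr h1, ← Complex.ofReal_tsum]
    rw [← Complex.ofReal_mul, ← partitionFn, inv_mul_cancel₀ hZ.ne', Complex.ofReal_one]

/-- The unnormalised sum tends to its `p = 0` term, which is `φ x` because `L_0 = 1`; the same limit
with constant coefficients `1` shows that the partition function tends to `1`. -/
theorem tendsto_gibbs (hr : ∀ j, 0 < r j) (φ : WeakDual ℂ (toeplitz Θ)) {β : ℕ → ℝ}
    (hβ : ∀ n, 0 < β n) (hlim : Tendsto β atTop atTop) :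
    Tendsto (fun n => gibbs hr (hβ n) φ) atTop (𝓝 φ) := by
  refine tendsto_iff_forall_eval_tendsto_topDualPairing.2 fun x => ?_
  change Tendsto (fun n => gibbs hr (hβ n) φ x) atTop (𝓝 (φ x))
  simp only [gibbs_apply]
  have h1 := (tendsto_tsum_boltzmann_mul hr (norm_apply_conj_genLevel_le φ · x)).comp hlim
  have h2 : Tendsto (fun n => ((partitionFn r (β n) : ℝ) : ℂ)) atTop (𝓝 1) := by
    have := (tendsto_tsum_boltzmann_mul hr (c := fun _ => 1) (C := 1) fun p => by simp).comp hlim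
    simpa only [partitionFn, Complex.ofReal_tsum, mul_one, Function.comp_def] using this
  have h3 := (h2.inv₀ one_ne_zero).mul h1
  simp only [inv_one, one_mul, genLevel_zero, star_one, mul_one] at h3
  simpa only [Complex.ofReal_inv, Function.comp_def] using h3

end Gibbs

/-! ### The KMS condition for Gibbs functionals -/

/-- Sums over `ℕ^k` of functions that are translates of each other by an element of `ℤ^k`. -/
theorem tsum_eq_tsum_of_translate {k : ℕ} {m : Fin k → ℤ} {F G : (Fin k → ℕ) → ℂ}
    (hFG : ∀ p q : Fin k → ℕ, (∀ j, (q j : ℤ) = p j + m j) → F p = G q)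
    (hF : ∀ p : Fin k → ℕ, (¬ ∃ q : Fin k → ℕ, ∀ j, (q j : ℤ) = p j + m j) → F p = 0)
    (hG : ∀ q : Fin k → ℕ, (¬ ∃ p : Fin k → ℕ, ∀ j, (q j : ℤ) = p j + m j) → G q = 0) :
    ∑' p, F p = ∑' q, G q := by
  -- `i q` is `q - m`, which lies in `ℕ^k` for `q` in the support of `G`; it is a bijection onto the
  -- support of `F`.
  choose i hi using fun q : Function.support G => not_imp_comm.1 (hG q) q.2
  refine tsum_eq_tsum_of_ne_zero_bij i (fun x y hxy => ?_) (fun p hp => ?_)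
    fun q => hFG _ _ (hi q)
  · refine Subtype.ext (funext fun j => ?_)
    have h1 := hi x j
    have h2 := hi y j
    rw [hxy] at h1
    omega
  · obtain ⟨q, hq⟩ := not_imp_comm.1 (hF p) hp
    have hq0 : G q ≠ 0 := by rw [← hFG _ _ hq]; exact hp
    refine ⟨⟨q, hq0⟩, funext fun j => ?_⟩
    have h1 := hi ⟨q, hq0⟩ j
    have h2 := hq j
    dsimp only at h1
    omega

section Kms

variable {k d : ℕ} {Θ : Matrix (Fin (k + d)) (Fin (k + d)) ℝ} {r : Fin k → ℝ} {β : ℝ}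
  {φ : WeakDual ℂ (toeplitz Θ)} {a b : toeplitz Θ} {f : ℂ → toeplitz Θ} {m : Fin k → ℤ}

theorem projQ_mul_self : projQ Θ * projQ Θ = projQ Θ := (isStarProjection_projQ Θ).isIdempotentElem

/-- As `b` has degree `m`, the compressed product splits through level `q` on the left side and
through level `p` on the right. The trace swaps the two corner blocks, and the block of `f(iβ)` is
that of `a` times `e^{-β(E_p - E_q)}`, exactly the ratio of the two weights. -/
theorem boltzmann_mul_apply_eq (hQ : ∀ x, φ (projQ Θ * x * projQ Θ) = φ x)
    (htr : ∀ x y, φ (projQ Θ * x * projQ Θ * (projQ Θ * y * projQ Θ)) =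
      φ (projQ Θ * y * projQ Θ * (projQ Θ * x * projQ Θ)))
    (hf : IsEntireOrbit (dynamics Θ (extendZero r)) a f) (hb : IsHomogeneous m b.1)
    {p q : Fin k → ℕ} (hpq : ∀ j, (q j : ℤ) = p j + m j) :
    (boltzmann r β p : ℂ) * φ (star (genLevel Θ p) * (a * b) * genLevel Θ p) =
      (boltzmann r β q : ℂ) *
        φ (star (genLevel Θ q) * (b * f (Complex.I * β)) * genLevel Θ q) := by
  have h1 : projQ Θ * (star (genLevel Θ p) * (a * b) * genLevel Θ p) * projQ Θ =
      projQ Θ * (star (genLevel Θ p) * a * genLevel Θ q) * projQ Θ *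
        (projQ Θ * (star (genLevel Θ q) * b * genLevel Θ p) * projQ Θ) := by
    have h := levelProj_mul_mul_genLevel_mul_projQ Θ hb hpq
    calc _ = projQ Θ * star (genLevel Θ p) * a * (b * genLevel Θ p * projQ Θ) := by
          simp only [mul_assoc]
      _ = projQ Θ * star (genLevel Θ p) * a *
          (genLevel Θ q * (projQ Θ * projQ Θ) * star (genLevel Θ q) *
            (b * genLevel Θ p * projQ Θ)) := by
          rw [projQ_mul_self, ← levelProj, h]
      _ = _ := by simp only [mul_assoc]
  have h2 : projQ Θ * (star (genLevel Θ q) * (b * f (Complex.I * β)) * genLevel Θ q) * projQ Θ =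
      projQ Θ * (star (genLevel Θ q) * b * genLevel Θ p) * projQ Θ *
        (projQ Θ * (star (genLevel Θ p) * f (Complex.I * β) * genLevel Θ q) * projQ Θ) := by
    have h := projQ_mul_star_genLevel_mul Θ hb hpq
    calc _ = projQ Θ * star (genLevel Θ q) * b * (f (Complex.I * β) * genLevel Θ q * projQ Θ) := by
          simp only [mul_assoc]
      _ = projQ Θ * star (genLevel Θ q) * b *
          (genLevel Θ p * (projQ Θ * projQ Θ) * star (genLevel Θ p)) *
            (f (Complex.I * β) * genLevel Θ q * projQ Θ) := by
          rw [projQ_mul_self, ← levelProj, h]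
      _ = _ := by simp only [mul_assoc]
  rw [← hQ (star (genLevel Θ p) * (a * b) * genLevel Θ p),
    ← hQ (star (genLevel Θ q) * (b * f (Complex.I * β)) * genLevel Θ q), h1, h2, htr,
    entireOrbit_coeff Θ hf p q, mul_smul_comm, weakDual_apply_smul]
  have hexp : (boltzmann r β p : ℂ) = boltzmann r β q *
      Complex.exp (((energy r p - energy r q : ℝ) : ℂ) * (Complex.I * β) * Complex.I) := by
    rw [boltzmann, boltzmann, Complex.ofReal_exp, Complex.ofReal_exp, ← Complex.exp_add]
    congr 1
    push_cast
    linear_combination -((energy r p : ℂ) - energy r q) * (β : ℂ) * Complex.I_mul_I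
  exact (congrArg (· * _) hexp).trans (mul_assoc _ _ _)

/-- Term `p` matches term `p + m`; terms without a partner vanish, since `b` annihilates the
corresponding block. -/
theorem tsum_boltzmann_mul_apply_eq (hQ : ∀ x, φ (projQ Θ * x * projQ Θ) = φ x)
    (htr : ∀ x y, φ (projQ Θ * x * projQ Θ * (projQ Θ * y * projQ Θ)) =
      φ (projQ Θ * y * projQ Θ * (projQ Θ * x * projQ Θ)))
    (hf : IsEntireOrbit (dynamics Θ (extendZero r)) a f) (hb : IsHomogeneous m b.1) :
    ∑' p, (boltzmann r β p : ℂ) * φ (star (genLevel Θ p) * (a * b) * genLevel Θ p) =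
      ∑' q, (boltzmann r β q : ℂ) *
        φ (star (genLevel Θ q) * (b * f (Complex.I * β)) * genLevel Θ q) := by
  refine tsum_eq_tsum_of_translate (fun p q hpq => boltzmann_mul_apply_eq hQ htr hf hb hpq)
    (fun p hc => ?_) fun q hc => ?_
  · have h : projQ Θ * (star (genLevel Θ p) * (a * b) * genLevel Θ p) * projQ Θ =
        projQ Θ * star (genLevel Θ p) * a * (b * genLevel Θ p * projQ Θ) := by
      simp only [mul_assoc]
    rw [← hQ, h, mul_genLevel_mul_projQ_eq_zero Θ hb hc, mul_zero, map_zero, mul_zero]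
  · have h : projQ Θ * (star (genLevel Θ q) * (b * f (Complex.I * β)) * genLevel Θ q) * projQ Θ =
        projQ Θ * star (genLevel Θ q) * b * (f (Complex.I * β) * genLevel Θ q * projQ Θ) := by
      simp only [mul_assoc]
    rw [← hQ, h, projQ_mul_star_genLevel_mul_eq_zero Θ hb hc, zero_mul, map_zero, mul_zero]

theorem gibbs_mem_kmsStates (hr : ∀ j, 0 < r j) (hβ : 0 < β)
    (hφ : φ ∈ stateSpace (1 : toeplitz Θ)) (hQ : ∀ x, φ (projQ Θ * x * projQ Θ) = φ x)
    (htr : ∀ x y, φ (projQ Θ * x * projQ Θ * (projQ Θ * y * projQ Θ)) =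
      φ (projQ Θ * y * projQ Θ * (projQ Θ * x * projQ Θ))) :
    gibbs hr hβ φ ∈ kmsStates (dynamics Θ (extendZero r)) β := by
  refine ⟨gibbs_mem_stateSpace hr hβ hφ, fun a f hf b => ?_⟩
  refine weakDual_eq_of_dense_span (dense_span_homogeneous Θ) (fun b hb => ?_) b
  obtain ⟨m, hm⟩ := hb
  rw [gibbs_apply, gibbs_apply, tsum_boltzmann_mul_apply_eq hQ htr hf hm]

end Kms

/-! ### Ground states and `KMS_∞` states -/

section Equilibrium

variable {k d : ℕ} {Θ : Matrix (Fin (k + d)) (Fin (k + d)) ℝ} {r : Fin k → ℝ}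
  {φ : WeakDual ℂ (toeplitz Θ)}

theorem energy_stdVec (j : Fin k) : energy r (level (stdVec (d := d) j)) = r j := by
  have h : ∀ i, level (stdVec (d := d) j) i = if i = j then 1 else 0 := fun i => by
    simp [level, stdVec, Pi.single_apply]
  simp [energy, h]

theorem dynamics_gen_stdVec (t : ℝ) (j : Fin k) :
    dynamics Θ (extendZero r) t (gen Θ (stdVec j)) =
      Complex.exp (r j * t * Complex.I) • gen Θ (stdVec j) := by
  rw [dynamics_gen, dotProduct_extendZero, energy_stdVec, Circle.coe_exp]
  push_cast
  rfl

theorem isEntireOrbit_gen_stdVec (j : Fin k) :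
    IsEntireOrbit (dynamics Θ (extendZero r)) (gen Θ (stdVec j))
      fun z => Complex.exp (r j * z * Complex.I) • gen Θ (stdVec j) :=
  ⟨by fun_prop, fun t => (dynamics_gen_stdVec t j).symm⟩

theorem isEntireOrbit_star_gen_stdVec (j : Fin k) :
    IsEntireOrbit (dynamics Θ (extendZero r)) (star (gen Θ (stdVec j)))
      fun z => Complex.exp (-(r j * z * Complex.I)) • star (gen Θ (stdVec j)) := by
  refine ⟨by fun_prop, fun t => ?_⟩
  have hs : star (Complex.exp (r j * t * Complex.I)) = Complex.exp (-(r j * t * Complex.I)) := by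
    rw [RCLike.star_def, ← Complex.exp_conj]; simp
  rw [map_star, dynamics_gen_stdVec, ← hs]
  exact (star_smul _ _).symm

theorem isStarProjection_gen_mul_star (p : Fin (k + d) → ℕ) :
    IsStarProjection (gen Θ p * star (gen Θ p)) := by
  refine ⟨?_, IsSelfAdjoint.mul_star_self _⟩
  change gen Θ p * star (gen Θ p) * (gen Θ p * star (gen Θ p)) = _
  rw [mul_assoc, ← mul_assoc (star _), star_gen_mul_gen, one_mul]

/-- A state that vanishes on the range projections of the `L_{e_j}`, `j ≤ k`, is supported
on the corner. -/
theorem apply_projQ_mul_mul_projQ (hφ : φ ∈ stateSpace (1 : toeplitz Θ))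
    (h : ∀ j : Fin k, φ (gen Θ (stdVec j) * star (gen Θ (stdVec j))) = 0) (x : toeplitz Θ) :
    φ (projQ Θ * x * projQ Θ) = φ x := by
  refine apply_compression_of_apply_prod hφ (isStarProjection_projQ Θ) rfl (fun q hq => ?_) x
  obtain ⟨j, rfl⟩ := (List.mem_ofFn' _ _).1 hq
  rw [sub_sub_cancel]
  exact ⟨isStarProjection_gen_mul_star _, h j⟩

/-- On `z = iy` the function `φ(L_{e_j} α_z(L_{e_j}^*))` is `e^{r_j y}` times the value in question,
and boundedness forces that value to be `0`. -/
theorem apply_gen_mul_star_of_mem_groundStates (hr : ∀ j, 0 < r j)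
    (hφ : φ ∈ groundStates (dynamics Θ (extendZero r))) (j : Fin k) :
    φ (gen Θ (stdVec j) * star (gen Θ (stdVec j))) = 0 := by
  obtain ⟨C, hC⟩ := hφ.2 _ _ _ _ (isEntireOrbit_gen_stdVec j) (isEntireOrbit_star_gen_stdVec j)
  by_contra h0
  have h1 : Tendsto (fun y : ℝ => Real.exp (r j * y) *
      ‖φ (gen Θ (stdVec j) * star (gen Θ (stdVec j)))‖) atTop atTop :=
    (Real.tendsto_exp_atTop.comp (tendsto_id.const_mul_atTop (hr j))).atTop_mul_const
      (norm_pos_iff.2 h0)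
  obtain ⟨y, hy, hy0⟩ := ((h1.eventually_gt_atTop C).and (eventually_gt_atTop 0)).exists
  have h2 := hC (y * Complex.I) (by simpa using hy0)
  rw [mul_smul_comm, weakDual_apply_smul, norm_mul, Complex.norm_exp] at h2
  have h3 : (-((r j : ℂ) * (y * Complex.I) * Complex.I)).re = r j * y := by
    simp
  rw [h3] at h2
  exact absurd h2 (not_le.2 hy)

theorem apply_gen_mul_star_of_mem_kmsStates {β : ℝ}
    (hφ : φ ∈ kmsStates (dynamics Θ (extendZero r)) β) (j : Fin k) :
    φ (gen Θ (stdVec j) * star (gen Θ (stdVec j))) = (Real.exp (-(r j * β)) : ℂ) := by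
  rw [hφ.2 _ _ (isEntireOrbit_gen_stdVec j), mul_smul_comm, star_gen_mul_gen, weakDual_apply_smul, hφ.1.2,
    mul_one, Complex.ofReal_exp]
  congr 1
  push_cast
  linear_combination (r j : ℂ) * β * Complex.I_mul_I

/-- The dynamics fixes `x`, so its entire orbit is constant and the KMS condition becomes the trace
identity. -/
theorem apply_mul_comm_of_mem_kmsStates {β : ℝ}
    (hφ : φ ∈ kmsStates (dynamics Θ (extendZero r)) β) {x : toeplitz Θ}
    (hx : projQ Θ * x * projQ Θ = x) (y : toeplitz Θ) : φ (x * y) = φ (y * x) :=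
  hφ.2 x (fun _ => x)
    ⟨differentiable_const _, fun t => (dynamics_eq_self_of_corner Θ r t hx).symm⟩ y

theorem tendsto_eval {φ : WeakDual ℂ (toeplitz Θ)} {ψ : ℕ → WeakDual ℂ (toeplitz Θ)}
    (h : Tendsto ψ atTop (𝓝 φ)) (x : toeplitz Θ) :
    Tendsto (fun n => ψ n x) atTop (𝓝 (φ x)) :=
  ((WeakDual.eval_continuous x).tendsto φ).comp h

theorem mem_stateSpace_of_mem_kmsInftyStates {α : ℝ → toeplitz Θ →⋆ₐ[ℂ] toeplitz Θ}
    (hφ : φ ∈ kmsInftyStates α) : φ ∈ stateSpace (1 : toeplitz Θ) := by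
  obtain ⟨β, ψ, -, hψ, hlim⟩ := hφ
  refine ⟨fun b => ge_of_tendsto' (tendsto_eval hlim _) fun n => (hψ n).1.1 b, ?_⟩
  refine tendsto_nhds_unique (tendsto_eval hlim 1) ?_
  simp only [fun n => (hψ n).1.2]
  exact tendsto_const_nhds

theorem apply_gen_mul_star_of_mem_kmsInftyStates (hr : ∀ j, 0 < r j)
    (hφ : φ ∈ kmsInftyStates (dynamics Θ (extendZero r))) (j : Fin k) :
    φ (gen Θ (stdVec j) * star (gen Θ (stdVec j))) = 0 := by
  obtain ⟨β, ψ, hβ, hψ, hlim⟩ := hφ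
  refine tendsto_nhds_unique (tendsto_eval hlim _) ?_
  simp only [fun n => apply_gen_mul_star_of_mem_kmsStates (hψ n) j]
  have h1 : Tendsto (fun n => Real.exp (-(r j * β n))) atTop (𝓝 0) :=
    Real.tendsto_exp_neg_atTop_nhds_zero.comp (hβ.const_mul_atTop (hr j))
  simpa [Function.comp_def] using (Complex.continuous_ofReal.tendsto 0).comp h1

theorem tInfty_mem_groundStates (hr : ∀ j, 0 < r j) {ω : WeakDual ℂ (cornerQ Θ)}
    (hω : ω ∈ stateSpace (unitQ Θ)) :
    tInfty Θ ω ∈ groundStates (dynamics Θ (extendZero r)) := by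
  have hφ : tInfty Θ ω ∈ stateSpace (1 : toeplitz Θ) := dilate_mem_stateSpace hω
  refine ⟨hφ, fun a b g f _ hf => ?_⟩
  refine ⟨‖WeakDual.toStrongDual (tInfty Θ ω)‖ * (‖projQ Θ * a‖ * ‖b * projQ Θ‖), fun z hz => ?_⟩
  -- `T_∞(ω)` sees only compressions, so `Q` may be placed next to `f z`, where the upper half plane
  -- bound applies.
  have h : tInfty Θ ω (a * f z) = tInfty Θ ω (projQ Θ * a * (f z * projQ Θ)) := by
    refine dilate_eq_of_compression_eq ω ?_
    have : projQ Θ * (projQ Θ * a * (f z * projQ Θ)) * projQ Θ =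
        (projQ Θ * projQ Θ) * (a * f z) * (projQ Θ * projQ Θ) := by simp only [mul_assoc]
    rw [this, projQ_mul_self]
  rw [h]
  refine ((WeakDual.toStrongDual (tInfty Θ ω)).le_opNorm _).trans ?_
  gcongr
  refine (norm_mul_le _ _).trans ?_
  gcongr
  exact norm_entireOrbit_mul_projQ_le Θ hr hf hz

theorem tInfty_mem_kmsInftyStates (hr : ∀ j, 0 < r j) {ω : WeakDual ℂ (cornerQ Θ)}
    (hω : ω ∈ tracialStateSpace (unitQ Θ)) :
    tInfty Θ ω ∈ kmsInftyStates (dynamics Θ (extendZero r)) := by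
  have hφ : tInfty Θ ω ∈ stateSpace (1 : toeplitz Θ) := dilate_mem_stateSpace hω.1
  have hpos : ∀ n : ℕ, (0 : ℝ) < n + 1 := fun n => by positivity
  -- Any positive sequence tending to infinity would do; the shift keeps `β > 0` at `n = 0`, so that
  -- the weights are summable.
  refine ⟨fun n => n + 1, fun n => gibbs hr (hpos n) (tInfty Θ ω), ?_, fun n => ?_, ?_⟩
  · exact tendsto_atTop_add_const_right _ _ tendsto_natCast_atTop_atTop
  · exact gibbs_mem_kmsStates hr _ hφ (dilate_apply_compression ω) (dilate_mul_comm hω.2)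
  · exact tendsto_gibbs hr _ hpos
      (tendsto_atTop_add_const_right _ _ tendsto_natCast_atTop_atTop)

theorem apply_mul_comm_of_mem_kmsInftyStates
    (hφ : φ ∈ kmsInftyStates (dynamics Θ (extendZero r))) {x : toeplitz Θ}
    (hx : projQ Θ * x * projQ Θ = x) (y : toeplitz Θ) : φ (x * y) = φ (y * x) := by
  obtain ⟨β, ψ, -, hψ, hlim⟩ := hφ
  refine tendsto_nhds_unique (tendsto_eval hlim _) ?_
  simp only [fun n => apply_mul_comm_of_mem_kmsStates (hψ n) hx]
  exact tendsto_eval hlim _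

end Equilibrium

end NCTorus

end

/-! ### The two homeomorphisms -/

theorem mainTheorem9 (k d : ℕ) (Θ : Matrix (Fin (k + d)) (Fin (k + d)) ℝ) (hΘ : Θᵀ = -Θ)
    (r : Fin k → ℝ) (hr : ∀ j, 0 < r j) :
    OpAlg.IsAffineHomeomorphOn (NCTorus.tInfty Θ)
        (OpAlg.stateSpace (NCTorus.unitQ Θ))
        (OpAlg.groundStates (NCTorus.dynamics Θ (NCTorus.extendZero r))) ∧
      OpAlg.IsAffineHomeomorphOn (NCTorus.tInfty Θ)
        (OpAlg.tracialStateSpace (NCTorus.unitQ Θ))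
        (OpAlg.kmsInftyStates (NCTorus.dynamics Θ (NCTorus.extendZero r))) := by
  have hground : ∀ φ ∈ OpAlg.groundStates (NCTorus.dynamics Θ (NCTorus.extendZero r)), ∀ x,
      φ (NCTorus.projQ Θ * x * NCTorus.projQ Θ) = φ x := fun φ hφ =>
    NCTorus.apply_projQ_mul_mul_projQ hφ.1
      (NCTorus.apply_gen_mul_star_of_mem_groundStates hr hφ)
  have hkms : ∀ φ ∈ OpAlg.kmsInftyStates (NCTorus.dynamics Θ (NCTorus.extendZero r)), ∀ x,
      φ (NCTorus.projQ Θ * x * NCTorus.projQ Θ) = φ x := fun φ hφ =>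
    NCTorus.apply_projQ_mul_mul_projQ (NCTorus.mem_stateSpace_of_mem_kmsInftyStates hφ)
      (NCTorus.apply_gen_mul_star_of_mem_kmsInftyStates hr hφ)
  constructor
  · exact OpAlg.isAffineHomeomorphOn_dilate (OpAlg.convex_stateSpace _)
      (fun ω hω => NCTorus.tInfty_mem_groundStates hr hω) hground
      fun φ hφ => OpAlg.restrictCorner_mem_stateSpace hφ.1 (hground φ hφ)
  · exact OpAlg.isAffineHomeomorphOn_dilate (OpAlg.convex_tracialStateSpace _)
      (fun ω hω => NCTorus.tInfty_mem_kmsInftyStates hr hω) hkms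
      fun φ hφ => ⟨OpAlg.restrictCorner_mem_stateSpace
          (NCTorus.mem_stateSpace_of_mem_kmsInftyStates hφ) (hkms φ hφ),
        fun x y => NCTorus.apply_mul_comm_of_mem_kmsInftyStates hφ x.2 y⟩
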